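/- **Theorem.** There is no design of type II. In detail: let $q=p^f>5$ with $p$ an odd prime and $f\ge 1$. There is no $2$-$\left(\frac{q(q-1)}{2},\,q-1,\,2\right)$ design $\mathcal D=(\mathcal P,\mathcal B)$, with $b=|\mathcal B|=\frac{q(q+1)}{2}$ blocks and $r=q+1$ blocks through each point, that admits a flag-transitive group of automorphisms $G\le \mathrm{Aut}(\mathcal D)$ such that the socle $T=\mathrm{Soc}(G)$ (the subgroup generated by the minimal normal subgroups of $G$) is isomorphic to $PSL(2,q)$, equivalently $PSL(2,q)\trianglelefteq G\le P\Gamma L(2,q)$, and such that for every point $x$ and every block $B$ the stabilizers $T_x$ and $T_B$ are dihedral groups of order $q+1$ and $q-1$, respectively. Here a $2$-$(v,k,\lambda)$ design is a set $\mathcal P$ of $v$ points with a set $\mathcal B$ of $k$-subsets of $\mathcal P$ (blocks) such that any two distinct points lie in exactly $\lambda$ blocks. An automorphism is a permutation of $\mathcal P$ preserving $\mathcal B$, and $G$ is flag-transitive if it is transitive on the pairs $(x,B)$ with $x\in B\in\mathcal B$. -/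

import Mathlib

open scoped Pointwise

/-- A family `𝓑` of subsets (blocks) of the point set `P` is a `2`-`(v, k, l)` design: there are
`v` points, every block has `k` points, and any two distinct points lie in exactly `l` blocks. -/
structure IsTwoDesign {P : Type*} (𝓑 : Set (Set P)) (v k l : ℕ) : Prop where
  card_points : Nat.card P = v
  card_block : ∀ B ∈ 𝓑, B.ncard = k
  card_pair : ∀ x y : P, x ≠ y → {B ∈ 𝓑 | x ∈ B ∧ y ∈ B}.ncard = l

/-- The automorphism group of `(P, 𝓑)`: the permutations of the points that preserve the
set of blocks (a permutation maps a block `B` to its image `g • B`, and `𝓑` to the set of the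
images of its members). -/
def designAut {P : Type*} (𝓑 : Set (Set P)) : Subgroup (Equiv.Perm P) :=
  MulAction.stabilizer (Equiv.Perm P) 𝓑

/-- `G` is transitive on the flags, the incident point-block pairs. -/
def IsFlagTransitive {P : Type*} (𝓑 : Set (Set P)) (G : Subgroup (Equiv.Perm P)) : Prop :=
  ∀ x y : P, ∀ B ∈ 𝓑, ∀ C ∈ 𝓑, x ∈ B → y ∈ C → ∃ g ∈ G, g x = y ∧ g • B = C

/-- A minimal normal subgroup: minimal among the nontrivial normal subgroups. -/
def IsMinimalNormal {G : Type*} [Group G] (N : Subgroup G) : Prop :=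
  Minimal (fun M : Subgroup G => M.Normal ∧ M ≠ ⊥) N

/-- The socle of a group: the subgroup generated by its minimal normal subgroups. -/
def groupSocle (G : Type*) [Group G] : Subgroup G :=
  sSup {N : Subgroup G | IsMinimalNormal N}

/-- `(P, 𝓑)` together with the group `G` of permutations of `P` is a design of type II over the
finite field `F` with `q` elements. Here `DihedralGroup n` is the dihedral group of order `2 * n`,
so the stabilizers in the socle of a point and of a block are dihedral of order `q + 1` and
`q - 1`; the block stabilizer is the setwise one. -/
structure IsTypeII (F : Type*) [Field F] [Finite F] (q : ℕ) {P : Type*}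
    (𝓑 : Set (Set P)) (G : Subgroup (Equiv.Perm P)) : Prop where
  card_field : Nat.card F = q
  odd : Odd q
  five_lt : 5 < q
  design : IsTwoDesign 𝓑 (q * (q - 1) / 2) (q - 1) 2
  card_blocks : 𝓑.ncard = q * (q + 1) / 2
  card_blocks_through : ∀ x : P, {B ∈ 𝓑 | x ∈ B}.ncard = q + 1
  le_aut : G ≤ designAut 𝓑
  flag_transitive : IsFlagTransitive 𝓑 G
  socle_iso : Nonempty (groupSocle G ≃* Matrix.ProjectiveSpecialLinearGroup (Fin 2) F)
  point_stabilizer : ∀ x : P,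
    Nonempty (MulAction.stabilizer (groupSocle G) x ≃* DihedralGroup ((q + 1) / 2))
  block_stabilizer : ∀ B ∈ 𝓑,
    Nonempty (MulAction.stabilizer (groupSocle G) B ≃* DihedralGroup ((q - 1) / 2))

/-! The socle `T` acts through a homomorphism `Φ` from `SL(2, F)` to the permutations of the points,
with kernel ±1. A rotation of order (q+1)/2 in a point stabilizer is elliptic: it is τ + X with X
traceless and X² = n a nonsquare, and the point stabilizer preserves ±X. Counting then identifies
the points with the pairs ±X of traceless matrices of square n, the internal points of a conic, with
`T` acting by conjugation (`IsDihedralAction.exists_isPointModel`).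

Let V be the set of vectors over the points of a block, so |V| = 2(q-1). Since `T` is transitive on
blocks, two points lie in two blocks, and each X has q+1 partners Y with tr(XY) = e when e ≠ ±2n,
the form tr(XY) takes each such value e exactly 4(q-1) times on V × V, and each of ±2n exactly
2(q-1) times (`IsPointModel.sum_trace`).

After a change of basis the block stabilizer in `T` contains the diagonal torus and an antidiagonal
element. An element of `G` fixing the block normalizes both `T` and the torus, so it acts
semilinearly. By flag-transitivity the ratios X₀₀²/n, for X in V, are then related to each other by
field endomorphisms. Hence no X₀₀ vanishes, and V consists of two torus orbits up to sign, with
representatives X and Y (`IsTorusInvariant.exists_two_orbits`). Along the orbits the trace form is a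
Laurent polynomial α + βy² + γy⁻².

Put a = X₀₀ and b = Y₀₀ and test the distribution of the trace form on three even functions
(`IsTorusInvariant.false`). The indicator of 0 gives n = a² + b². The function e² gives 10n² = 0, so
the characteristic is 5. Then q ≥ 25, and e⁴ gives a⁴ + a²b² + b⁴ = 0, which in characteristic 5
says n = (2b²/a)², contradicting that n is a nonsquare. -/

open Matrix

/-! ### Dihedral stabilizers and the lift of the socle action to SL(2, F) -/

/-- A group isomorphic to a dihedral group of order `2 * n` has a rotation of order `n`
generating every element of order greater than two, and a reflection inverting it. -/
theorem exists_rotation_of_mulEquiv_dihedralGroup {H : Type*} [Group H] {n : ℕ}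
    (e : H ≃* DihedralGroup n) :
    ∃ ρ r : H, orderOf ρ = n ∧ r * ρ * r⁻¹ = ρ⁻¹ ∧
      (∀ h : H, h * ρ * h⁻¹ = ρ ∨ h * ρ * h⁻¹ = ρ⁻¹) ∧
      ∀ h : H, 2 < orderOf h → h ∈ Subgroup.zpowers ρ := by
  have hsr : ∀ i : ZMod n, DihedralGroup.sr i * DihedralGroup.r 1 * (DihedralGroup.sr i)⁻¹ =
      (DihedralGroup.r 1)⁻¹ := by
    intro i
    simp
  refine ⟨e.symm (DihedralGroup.r 1), e.symm (DihedralGroup.sr 0), ?_, ?_, ?_, ?_⟩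
  · rw [MulEquiv.orderOf_eq, DihedralGroup.orderOf_r_one]
  · rw [← map_inv, ← map_inv, ← map_mul, ← map_mul, hsr]
  · intro h
    obtain ⟨d, rfl⟩ := e.symm.surjective h
    simp only [← map_inv, ← map_mul, e.symm.injective.eq_iff]
    cases d with
    | r i => left; simp
    | sr i => right; exact hsr i
  · intro h hh
    obtain ⟨d, rfl⟩ := e.symm.surjective h
    rw [MulEquiv.orderOf_eq] at hh
    cases d with
    | r i =>
      refine Subgroup.mem_zpowers_iff.2 ⟨(i.cast : ℤ), ?_⟩
      rw [← map_zpow, DihedralGroup.r_zpow]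
      simp
    | sr i => rw [DihedralGroup.orderOf_sr] at hh; exact absurd hh (lt_irrefl _)

/-- The data of a homomorphism `Φ` from `SL(2, F)` to the permutations of the points of a design
that induces a faithful action of `PSL(2, F)` as a normal subgroup of `G`, with dihedral
stabilizers of points and blocks. -/
structure IsDihedralAction {F : Type*} [Field F] {P : Type*} (q : ℕ) (𝓑 : Set (Set P))
    (G : Subgroup (Equiv.Perm P)) (Φ : SpecialLinearGroup (Fin 2) F →* Equiv.Perm P) : Prop where
  map_eq_one : ∀ M, Φ M = 1 ↔ (M = 1 ∨ M = -1)
  normal : ∀ g ∈ G, ∀ M, ∃ M', g * Φ M * g⁻¹ = Φ M'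
  point : ∀ x, ∃ M, orderOf (Φ M) = (q + 1) / 2 ∧ Φ M x = x ∧
    ∀ h, Φ h x = x → Φ (h * M * h⁻¹) = Φ M ∨ Φ (h * M * h⁻¹) = Φ M⁻¹
  block : ∀ B ∈ 𝓑, ∃ M R, orderOf (Φ M) = (q - 1) / 2 ∧ Φ M • B = B ∧ Φ R • B = B ∧
    Φ (R * M * R⁻¹) = Φ M⁻¹ ∧
    ∀ σ ∈ Φ.range, σ • B = B → 2 < orderOf σ → σ ∈ Subgroup.zpowers (Φ M)
  blocks_transitive : (∀ x y, ∃ M, Φ M x = y) → ∀ B ∈ 𝓑, ∀ C ∈ 𝓑, ∃ M, Φ M • B = C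

theorem mem_center_fin_two_iff {F : Type*} [Field F]
    (M : SpecialLinearGroup (Fin 2) F) :
    M ∈ Subgroup.center (SpecialLinearGroup (Fin 2) F) ↔ M = 1 ∨ M = -1 := by
  rw [Matrix.SpecialLinearGroup.mem_center_iff]
  constructor
  · rintro ⟨r, hr, h⟩
    rw [Fintype.card_fin, sq_eq_one_iff] at hr
    rcases hr with rfl | rfl
    · left; ext i j; rw [← h]; simp
    · right; ext i j
      rw [← h, Matrix.SpecialLinearGroup.coe_neg, Matrix.SpecialLinearGroup.coe_one, map_neg,
        map_one]
  · rintro (rfl | rfl)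
    · exact ⟨1, by simp, by simp⟩
    · refine ⟨-1, by simp, ?_⟩
      rw [Matrix.SpecialLinearGroup.coe_neg, Matrix.SpecialLinearGroup.coe_one, map_neg, map_one]

theorem groupSocle_normal (G : Type*) [Group G] : (groupSocle G).Normal :=
  Subgroup.sSup_normal _ fun N h => (show IsMinimalNormal N from h).prop.1

theorem orbit_ncard_mul_stabilizer {H X : Type*} [Group H] [MulAction H X] (x : X) :
    (MulAction.orbit H x).ncard * Nat.card (MulAction.stabilizer H x) = Nat.card H := by
  rw [← MulAction.index_stabilizer, mul_comm, Subgroup.card_mul_index]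

/-- Block transitivity is pure counting: if `T` is transitive on points, then |T| = (q(q-1)/2)(q+1),
so the orbit of a block, whose stabilizer has order q-1, has q(q+1)/2 members and exhausts `𝓑`. -/
theorem IsTypeII.exists_isDihedralAction {F : Type*} [Field F] [Finite F] {q : ℕ} {P : Type*}
    {𝓑 : Set (Set P)} {G : Subgroup (Equiv.Perm P)} (h : IsTypeII F q 𝓑 G) :
    ∃ Φ : SpecialLinearGroup (Fin 2) F →* Equiv.Perm P, IsDihedralAction q 𝓑 G Φ := by
  classical
  obtain ⟨e⟩ := h.socle_iso
  have hq := h.five_lt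
  obtain ⟨k, hk⟩ := h.odd
  set π : SpecialLinearGroup (Fin 2) F →* groupSocle G :=
    e.symm.toMonoidHom.comp (QuotientGroup.mk' _) with hπ
  have hπs : Function.Surjective π := e.symm.surjective.comp (QuotientGroup.mk'_surjective _)
  set ι : groupSocle G →* Equiv.Perm P := G.subtype.comp (groupSocle G).subtype with hι
  have hιi : Function.Injective ι := G.subtype_injective.comp (groupSocle G).subtype_injective
  have hιx : ∀ (t : groupSocle G) (x : P), ι t x = t • x := fun _ _ => rfl
  have hιB : ∀ (t : groupSocle G) (B : Set P), ι t • B = t • B := fun _ _ => rfl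
  have hι𝓑 : ∀ (t : groupSocle G), ∀ B ∈ 𝓑, ι t • B ∈ 𝓑 := by
    intro t B hB
    have h1 : ι t ∈ designAut 𝓑 := h.le_aut t.1.2
    have h2 : ι t • 𝓑 = 𝓑 := h1
    rw [← h2]
    exact Set.smul_mem_smul_set hB
  refine ⟨ι.comp π, ?_, ?_, ?_, ?_, ?_⟩
  · intro M
    rw [← mem_center_fin_two_iff, MonoidHom.comp_apply, map_eq_one_iff ι hιi,
      hπ, MonoidHom.comp_apply]
    simp
  · intro g hg M
    have hn := (groupSocle_normal G).conj_mem (π M).1 (π M).2 ⟨g, hg⟩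
    obtain ⟨M', hM'⟩ := hπs ⟨_, hn⟩
    refine ⟨M', ?_⟩
    rw [MonoidHom.comp_apply ι π M', hM']
    rfl
  · intro x
    obtain ⟨f⟩ := h.point_stabilizer x
    obtain ⟨ρ, -, h1, -, h2, -⟩ := exists_rotation_of_mulEquiv_dihedralGroup f
    obtain ⟨M, hM⟩ := hπs ρ
    refine ⟨M, ?_, ?_, ?_⟩
    · rw [MonoidHom.comp_apply, orderOf_injective ι hιi, hM, ← h1]
      exact orderOf_injective (Subgroup.subtype _) (Subgroup.subtype_injective _) ρ
    · rw [MonoidHom.comp_apply, hM, hιx]; exact ρ.2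
    · intro a ha
      rcases h2 ⟨π a, ha⟩ with h3 | h3
      · left
        simp only [MonoidHom.comp_apply, map_mul, map_inv, hM]
        have hc := congrArg (ι.comp (MulAction.stabilizer (groupSocle G) x).subtype) h3
        simp only [map_mul, map_inv] at hc
        exact hc
      · right
        simp only [MonoidHom.comp_apply, map_mul, map_inv, hM]
        have hc := congrArg (ι.comp (MulAction.stabilizer (groupSocle G) x).subtype) h3
        simp only [map_mul, map_inv] at hc
        exact hc
  · intro B hB
    obtain ⟨f⟩ := h.block_stabilizer B hB
    obtain ⟨ρ, r, h1, h2, -, h4⟩ := exists_rotation_of_mulEquiv_dihedralGroup f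
    obtain ⟨M, hM⟩ := hπs ρ
    obtain ⟨R, hR⟩ := hπs r
    refine ⟨M, R, ?_, ?_, ?_, ?_, ?_⟩
    · rw [MonoidHom.comp_apply, orderOf_injective ι hιi, hM, ← h1]
      exact orderOf_injective (Subgroup.subtype _) (Subgroup.subtype_injective _) ρ
    · rw [MonoidHom.comp_apply, hM, hιB]; exact ρ.2
    · rw [MonoidHom.comp_apply, hR, hιB]; exact r.2
    · simp only [MonoidHom.comp_apply, map_mul, map_inv, hM, hR]
      have hc := congrArg (ι.comp (MulAction.stabilizer (groupSocle G) B).subtype) h2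
      simp only [map_mul, map_inv] at hc
      exact hc
    · rintro _ ⟨a, rfl⟩ ha ho
      have h5 := h4 ⟨π a, ha⟩ (by
        rwa [← orderOf_injective (Subgroup.subtype _) (Subgroup.subtype_injective _),
          ← orderOf_injective ι hιi])
      obtain ⟨i, hi⟩ := Subgroup.mem_zpowers_iff.1 h5
      refine Subgroup.mem_zpowers_iff.2 ⟨i, ?_⟩
      rw [MonoidHom.comp_apply, hM, ← map_zpow, MonoidHom.comp_apply]
      have hc := congrArg (ι.comp (MulAction.stabilizer (groupSocle G) B).subtype) hi
      simp only [map_zpow] at hc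
      exact hc
  · intro ht B hB C hC
    have hcP := h.design.card_points
    have e1 : q * (q - 1) / 2 = q * k := by
      rw [hk, Nat.add_sub_cancel, mul_left_comm, Nat.mul_div_cancel_left _ two_pos]
    have e2 : q * (q + 1) / 2 = q * (k + 1) := by
      rw [show q + 1 = 2 * (k + 1) by omega, mul_left_comm, Nat.mul_div_cancel_left _ two_pos]
    have hpos : 0 < Nat.card P := by
      rw [hcP, e1]; apply Nat.mul_pos <;> omega
    obtain ⟨⟨x⟩, hfin⟩ := Nat.card_pos_iff.1 hpos
    have hT1 := orbit_ncard_mul_stabilizer (H := groupSocle G) x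
    have hT2 := orbit_ncard_mul_stabilizer (H := groupSocle G) B
    have ho : MulAction.orbit (groupSocle G) x = Set.univ := by
      refine Set.eq_univ_of_forall fun y => ?_
      obtain ⟨M, hM⟩ := ht x y
      exact ⟨π M, hM⟩
    obtain ⟨f⟩ := h.point_stabilizer x
    obtain ⟨f'⟩ := h.block_stabilizer B hB
    rw [ho, Set.ncard_univ, hcP, e1, Nat.card_congr f.toEquiv, DihedralGroup.nat_card] at hT1
    rw [← hT1, Nat.card_congr f'.toEquiv, DihedralGroup.nat_card,
      show 2 * ((q - 1) / 2) = 2 * k by omega, show 2 * ((q + 1) / 2) = 2 * (k + 1) by omega,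
      show q * k * (2 * (k + 1)) = q * (k + 1) * (2 * k) by ring] at hT2
    have hob := Nat.eq_of_mul_eq_mul_right (by omega) hT2
    have hsub : MulAction.orbit (groupSocle G) B ⊆ 𝓑 := by
      rintro _ ⟨t, rfl⟩
      exact hι𝓑 t B hB
    have heq : MulAction.orbit (groupSocle G) B = 𝓑 := by
      refine Set.eq_of_subset_of_ncard_le hsub ?_ (Set.toFinite _)
      rw [h.card_blocks, e2, hob]
    rw [← heq] at hC
    obtain ⟨t, rfl⟩ := hC
    obtain ⟨M, rfl⟩ := hπs t
    exact ⟨M, rfl⟩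

/-! ### The q-th power map on SL(2, q) -/

section SpecialLinear

variable {F : Type*} [Field F]

/-- The discriminant of the characteristic polynomial of an element of `SL(2, F)`. -/
def slDisc (M : Matrix.SpecialLinearGroup (Fin 2) F) : F := (M 0 0 + M 1 1) ^ 2 - 4

/-- The upper unitriangular element of `SL(2, F)` with entry `b`. -/
def slUpper (b : F) : Matrix.SpecialLinearGroup (Fin 2) F :=
  ⟨!![1, b; 0, 1], by simp⟩

/-- The diagonal element of `SL(2, F)` with entries `t` and `t⁻¹`. -/
def slDiag (t : Fˣ) : Matrix.SpecialLinearGroup (Fin 2) F :=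
  ⟨!![(t : F), 0; 0, ((t⁻¹ : Fˣ) : F)], by simp [det_fin_two]⟩

/-- The antidiagonal element of `SL(2, F)` with entries `s` and `-s⁻¹`. -/
def slAnti (s : Fˣ) : Matrix.SpecialLinearGroup (Fin 2) F :=
  ⟨!![0, (s : F); -((s⁻¹ : Fˣ) : F), 0], by simp [det_fin_two]⟩

theorem sl_ext_iff {A B : Matrix.SpecialLinearGroup (Fin 2) F} :
    A = B ↔ A 0 0 = B 0 0 ∧ A 0 1 = B 0 1 ∧ A 1 0 = B 1 0 ∧ A 1 1 = B 1 1 := by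
  rw [Matrix.SpecialLinearGroup.ext_iff]
  simp only [Fin.forall_fin_two]
  tauto

theorem sl_det (A : Matrix.SpecialLinearGroup (Fin 2) F) :
    A 0 0 * A 1 1 - A 0 1 * A 1 0 = 1 := by
  rw [← det_fin_two]; exact A.2

theorem sl_mul_apply (A B : Matrix.SpecialLinearGroup (Fin 2) F) (i j : Fin 2) :
    (A * B) i j = A i 0 * B 0 j + A i 1 * B 1 j := by
  change (A.1 * B.1) i j = _
  rw [Matrix.mul_apply, Fin.sum_univ_two]

theorem sl_neg_apply (A : Matrix.SpecialLinearGroup (Fin 2) F) (i j : Fin 2) :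
    (-A) i j = - A i j := by
  rw [Matrix.SpecialLinearGroup.coe_neg, Matrix.neg_apply]

@[simp] theorem slUpper_apply_0_0 (b : F) : slUpper b 0 0 = 1 := rfl

@[simp] theorem slUpper_apply_0_1 (b : F) : slUpper b 0 1 = b := rfl

@[simp] theorem slUpper_apply_1_0 (b : F) : slUpper b 1 0 = 0 := rfl

@[simp] theorem slUpper_apply_1_1 (b : F) : slUpper b 1 1 = 1 := rfl

@[simp] theorem slDiag_apply_0_0 (t : Fˣ) : slDiag t 0 0 = t := rfl

@[simp] theorem slDiag_apply_0_1 (t : Fˣ) : slDiag t 0 1 = 0 := rfl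

@[simp] theorem slDiag_apply_1_0 (t : Fˣ) : slDiag t 1 0 = 0 := rfl

@[simp] theorem slDiag_apply_1_1 (t : Fˣ) : slDiag t 1 1 = ((t⁻¹ : Fˣ) : F) := rfl

@[simp] theorem slAnti_apply_0_0 (s : Fˣ) : slAnti s 0 0 = 0 := rfl

@[simp] theorem slAnti_apply_0_1 (s : Fˣ) : slAnti s 0 1 = s := rfl

@[simp] theorem slAnti_apply_1_0 (s : Fˣ) : slAnti s 1 0 = -((s⁻¹ : Fˣ) : F) := rfl

@[simp] theorem slAnti_apply_1_1 (s : Fˣ) : slAnti s 1 1 = 0 := rfl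

theorem sl_inv_apply (A : Matrix.SpecialLinearGroup (Fin 2) F) :
    A⁻¹ 0 0 = A 1 1 ∧ A⁻¹ 0 1 = -A 0 1 ∧ A⁻¹ 1 0 = -A 1 0 ∧ A⁻¹ 1 1 = A 0 0 := by
  rw [Matrix.SpecialLinearGroup.coe_inv, adjugate_fin_two]
  simp

theorem slDiag_mul (s t : Fˣ) : slDiag (s * t) = slDiag s * slDiag t := by
  rw [sl_ext_iff]
  simp only [sl_mul_apply]
  simp [mul_comm]

theorem slDiag_one : slDiag (1 : Fˣ) = 1 := by
  rw [sl_ext_iff]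
  simp

theorem slUpper_add (a b : F) : slUpper (a + b) = slUpper a * slUpper b := by
  rw [sl_ext_iff]
  simp only [sl_mul_apply]
  simp [add_comm]

/-- The diagonal elements of `SL(2, F)` as a homomorphism. -/
def slDiagHom : Fˣ →* Matrix.SpecialLinearGroup (Fin 2) F where
  toFun := slDiag
  map_one' := slDiag_one
  map_mul' := slDiag_mul

theorem slDiag_conj_slUpper (t : Fˣ) (b : F) :
    slDiag t * slUpper b * (slDiag t)⁻¹ = slUpper (t ^ 2 * b) := by
  rw [mul_inv_eq_iff_eq_mul, sl_ext_iff]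
  simp only [sl_mul_apply]
  simp
  field_simp

theorem isSquare_div_four_iff (h2 : (2 : F) ≠ 0) (a : F) : IsSquare (a / 4) ↔ IsSquare a := by
  constructor
  · rintro ⟨r, hr⟩
    refine ⟨2 * r, ?_⟩
    have h4 : (4 : F) ≠ 0 := by rw [show (4 : F) = 2 * 2 by norm_num]; exact mul_ne_zero h2 h2
    rw [div_eq_iff h4] at hr
    rw [hr]; ring
  · rintro ⟨r, hr⟩
    refine ⟨r / 2, ?_⟩
    rw [hr, div_mul_div_comm]; norm_num

variable [Finite F]

/-- The `q`-th power of a matrix `t + X` with `X ^ 2` the scalar `d`. -/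
theorem pow_natCard_scalar_add {q : ℕ} (hq : Nat.card F = q) {k : ℕ} (hk : q = 2 * k + 1)
    (t d : F) (X : Matrix (Fin 2) (Fin 2) F) (hX : X * X = d • 1) :
    (t • 1 + X) ^ q = t • 1 + d ^ k • X := by
  have := Fintype.ofFinite F
  obtain ⟨p, hp⟩ := CharP.exists F
  obtain ⟨m, hpp, hm⟩ := FiniteField.card F p
  have := Fact.mk hpp
  rw [← Nat.card_eq_fintype_card, hq] at hm
  have hc : Commute (t • (1 : Matrix (Fin 2) (Fin 2) F)) X :=
    (Commute.one_left X).smul_left t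
  have h1 : (t • 1 + X) ^ q = (t • (1 : Matrix (Fin 2) (Fin 2) F)) ^ q + X ^ q := by
    rw [hm]; exact add_pow_char_pow_of_commute p _ hc
  have h2 : t ^ q = t := by
    rw [← hq, Nat.card_eq_fintype_card]; exact FiniteField.pow_card t
  rw [h1, smul_pow, one_pow, h2]
  congr 1
  rw [hk, pow_succ, pow_mul, pow_two, hX, smul_pow, one_pow, smul_mul_assoc, one_mul]

/-- With t half the trace, M = t + X, where X² is the scalar `slDisc M / 4` by Cayley-Hamilton. The
power k = (q-1)/2 of that scalar is its quadratic character, so three cases follow according to the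
discriminant. -/
theorem sl_pow_card_coe {q : ℕ} (hq : Nat.card F = q) {k : ℕ} (hk : q = 2 * k + 1)
    (h2 : (2 : F) ≠ 0) (M : Matrix.SpecialLinearGroup (Fin 2) F) :
    ((M ^ q : Matrix.SpecialLinearGroup (Fin 2) F) : Matrix (Fin 2) (Fin 2) F) =
      ((M 0 0 + M 1 1) / 2) • 1 + (slDisc M / 4) ^ k •
        ((M : Matrix (Fin 2) (Fin 2) F) - ((M 0 0 + M 1 1) / 2) • 1) := by
  have h4 : (4 : F) ≠ 0 := by rw [show (4 : F) = 2 * 2 by norm_num]; exact mul_ne_zero h2 h2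
  rw [Matrix.SpecialLinearGroup.coe_pow]
  conv_lhs => rw [← add_sub_cancel (((M 0 0 + M 1 1) / 2) • (1 : Matrix (Fin 2) (Fin 2) F)) M.1]
  refine pow_natCard_scalar_add hq hk _ _ _ ?_
  have hd := sl_det M
  ext i j
  fin_cases i <;> fin_cases j <;>
    simp [Matrix.mul_apply, Fin.sum_univ_two, slDisc] <;> field_simp <;>
    first | ring1 | linear_combination (-16 : F) * hd

theorem sl_pow_card_of_isSquare {q : ℕ} (hq : Nat.card F = q) {k : ℕ} (hk : q = 2 * k + 1)
    (h2 : (2 : F) ≠ 0) {M : Matrix.SpecialLinearGroup (Fin 2) F} (h0 : slDisc M ≠ 0)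
    (hs : IsSquare (slDisc M)) : M ^ q = M := by
  have := Fintype.ofFinite F
  have h4 : (4 : F) ≠ 0 := by rw [show (4 : F) = 2 * 2 by norm_num]; exact mul_ne_zero h2 h2
  obtain ⟨r, hr⟩ := (isSquare_div_four_iff h2 _).2 hs
  have hr0 : r ≠ 0 := by
    rintro rfl
    rw [mul_zero, div_eq_zero_iff] at hr
    exact hr.elim h0 h4
  have h1 : (slDisc M / 4) ^ k = 1 := by
    rw [hr, ← pow_two, ← pow_mul, show 2 * k = q - 1 by omega, ← hq, Nat.card_eq_fintype_card]
    exact FiniteField.pow_card_sub_one_eq_one r hr0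
  apply Subtype.ext
  rw [sl_pow_card_coe hq hk h2, h1, one_smul, add_sub_cancel]

/-- By Euler's criterion the factor in front of X is -1, and t - X is the adjugate of M = t + X. -/
theorem sl_pow_card_of_not_isSquare {q : ℕ} (hq : Nat.card F = q) {k : ℕ} (hk : q = 2 * k + 1)
    (h2 : (2 : F) ≠ 0) {M : Matrix.SpecialLinearGroup (Fin 2) F}
    (hs : ¬ IsSquare (slDisc M)) : M ^ q = M⁻¹ := by
  have := Fintype.ofFinite F
  have h4 : (4 : F) ≠ 0 := by rw [show (4 : F) = 2 * 2 by norm_num]; exact mul_ne_zero h2 h2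
  have hs' : ¬ IsSquare (slDisc M / 4) := fun h => hs ((isSquare_div_four_iff h2 _).1 h)
  have h0 : slDisc M / 4 ≠ 0 := fun h => hs' (h ▸ IsSquare.zero)
  have hc : ringChar F ≠ 2 := fun h => h2 (by
    have := ringChar.Nat.cast_ringChar (R := F)
    rwa [h] at this)
  have h1 : (slDisc M / 4) ^ k = -1 := by
    have h3 : Fintype.card F / 2 = k := by rw [← Nat.card_eq_fintype_card, hq]; omega
    have h5 := FiniteField.pow_dichotomy hc h0
    rw [FiniteField.isSquare_iff hc h0] at hs'
    rw [h3] at h5 hs'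
    exact h5.resolve_left hs'
  obtain ⟨i1, i2, i3, i4⟩ := sl_inv_apply M
  rw [sl_ext_iff, sl_pow_card_coe hq hk h2, h1, i1, i2, i3, i4]
  simp
  constructor <;> field_simp <;> ring

theorem sl_pow_card_of_disc_eq_zero {q : ℕ} (hq : Nat.card F = q) {k : ℕ} (hk : q = 2 * k + 1)
    (hk0 : k ≠ 0) (h2 : (2 : F) ≠ 0) {M : Matrix.SpecialLinearGroup (Fin 2) F}
    (h0 : slDisc M = 0) : M ^ q = 1 ∨ M ^ q = -1 := by
  have h1 : (M 0 0 + M 1 1 - 2) * (M 0 0 + M 1 1 + 2) = 0 := by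
    rw [← h0, slDisc]; ring
  have h3 : ((M ^ q : Matrix.SpecialLinearGroup (Fin 2) F) : Matrix (Fin 2) (Fin 2) F) =
      ((M 0 0 + M 1 1) / 2) • 1 := by
    rw [sl_pow_card_coe hq hk h2, h0, zero_div, zero_pow hk0, zero_smul, add_zero]
  rcases mul_eq_zero.1 h1 with h | h
  · left
    apply Subtype.ext
    rw [h3, sub_eq_zero.1 h, div_self h2, one_smul]
    rfl
  · right
    apply Subtype.ext
    rw [h3, eq_neg_of_add_eq_zero_left h, neg_div, div_self h2, neg_smul, one_smul,
      Matrix.SpecialLinearGroup.coe_neg]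
    rfl

end SpecialLinear

/-! ### Elliptic and hyperbolic elements of PSL(2, q) -/

section Order

variable {F : Type*} [Field F] {H : Type*} [Group H]
  {Φ : Matrix.SpecialLinearGroup (Fin 2) F →* H}

theorem map_neg_of_map_eq_one (hΦ : ∀ M, Φ M = 1 ↔ (M = 1 ∨ M = -1))
    (A : Matrix.SpecialLinearGroup (Fin 2) F) : Φ (-A) = Φ A := by
  rw [← neg_one_mul, map_mul, (hΦ (-1)).2 (Or.inr rfl), one_mul]

theorem map_eq_map_iff (hΦ : ∀ M, Φ M = 1 ↔ (M = 1 ∨ M = -1))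
    (A B : Matrix.SpecialLinearGroup (Fin 2) F) : Φ A = Φ B ↔ A = B ∨ A = -B := by
  constructor
  · intro h
    have h1 : Φ (A * B⁻¹) = 1 := by rw [map_mul, map_inv, h, mul_inv_cancel]
    rcases (hΦ _).1 h1 with h2 | h2
    · left; rwa [mul_inv_eq_one] at h2
    · right; rw [mul_inv_eq_iff_eq_mul] at h2; rw [h2, neg_one_mul]
  · rintro (rfl | rfl)
    · rfl
    · exact map_neg_of_map_eq_one hΦ B

theorem sl_sq_eq_neg_one {M : Matrix.SpecialLinearGroup (Fin 2) F} (h : M 0 0 + M 1 1 = 0) :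
    M * M = -1 := by
  have hd := sl_det M
  have h1 := eq_neg_of_add_eq_zero_left h
  rw [h1] at hd
  rw [sl_ext_iff]
  simp only [sl_mul_apply, sl_neg_apply]
  simp [h1]
  refine ⟨?_, ?_, ?_, ?_⟩ <;> first | ring1 | linear_combination -hd

theorem trace_ne_zero_of_two_lt_orderOf (hΦ : ∀ M, Φ M = 1 ↔ (M = 1 ∨ M = -1))
    {M : Matrix.SpecialLinearGroup (Fin 2) F} (h : 2 < orderOf (Φ M)) : M 0 0 + M 1 1 ≠ 0 := by
  intro h0
  have h1 : Φ M ^ 2 = 1 := by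
    rw [pow_two, ← map_mul, sl_sq_eq_neg_one h0]
    exact (hΦ _).2 (Or.inr rfl)
  exact absurd (Nat.le_of_dvd two_pos (orderOf_dvd_of_pow_eq_one h1)) (not_le.2 h)

variable [Finite F]

/-- An element of `PSL(2, q)` of order `(q + 1) / 2` is elliptic. -/
theorem not_isSquare_disc_of_orderOf (hΦ : ∀ M, Φ M = 1 ↔ (M = 1 ∨ M = -1))
    {q : ℕ} (hq : Nat.card F = q) (hodd : Odd q) (h5 : 5 < q) (h2 : (2 : F) ≠ 0)
    {M : Matrix.SpecialLinearGroup (Fin 2) F} (h : orderOf (Φ M) = (q + 1) / 2) :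
    ¬ IsSquare (slDisc M) := by
  obtain ⟨k, hk⟩ := hodd
  have h1 : Φ M ^ (q + 1) = 1 := by
    apply orderOf_dvd_iff_pow_eq_one.1
    rw [h]; exact Nat.div_dvd_of_dvd (by omega)
  intro hs
  by_cases h0 : slDisc M = 0
  · have h3 : Φ M ^ q = 1 := by
      rw [← map_pow, hΦ]
      exact sl_pow_card_of_disc_eq_zero hq hk (by omega) h2 h0
    rw [pow_succ, h3, one_mul] at h1
    rw [h1, orderOf_one] at h
    omega
  -- Here M^q = M, so the relation of exponent q+1 becomes Φ(M)² = 1, whereas (q+1)/2 > 2.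
  · rw [pow_succ, ← map_pow, sl_pow_card_of_isSquare hq hk h2 h0 hs, ← pow_two] at h1
    have := Nat.le_of_dvd two_pos (orderOf_dvd_of_pow_eq_one h1)
    omega

/-- An element of `PSL(2, q)` of order `(q - 1) / 2` is hyperbolic. -/
theorem isSquare_disc_of_orderOf (hΦ : ∀ M, Φ M = 1 ↔ (M = 1 ∨ M = -1))
    {q : ℕ} (hq : Nat.card F = q) (hodd : Odd q) (h5 : 5 < q) (h2 : (2 : F) ≠ 0)
    {M : Matrix.SpecialLinearGroup (Fin 2) F} (h : orderOf (Φ M) = (q - 1) / 2) :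
    IsSquare (slDisc M) ∧ slDisc M ≠ 0 := by
  obtain ⟨k, hk⟩ := hodd
  have h1 : Φ M ^ (2 * k) = 1 := by
    apply orderOf_dvd_iff_pow_eq_one.1
    rw [h, show 2 * k = q - 1 by omega]; exact Nat.div_dvd_of_dvd (by omega)
  have h1' : Φ M ^ q = Φ M := by rw [hk, pow_succ, h1, one_mul]
  refine ⟨?_, ?_⟩
  · by_contra hs
    rw [← map_pow, sl_pow_card_of_not_isSquare hq hk h2 hs, map_inv, inv_eq_iff_mul_eq_one,
      ← pow_two] at h1'
    -- An element with nonsquare discriminant would have Φ(M)² = 1; this is excluded by (q-1)/2 > 2,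
    -- which needs q > 5.
    have := Nat.le_of_dvd two_pos (orderOf_dvd_of_pow_eq_one h1')
    omega
  · intro h0
    have h3 : Φ M ^ q = 1 := by
      rw [← map_pow, hΦ]
      exact sl_pow_card_of_disc_eq_zero hq hk (by omega) h2 h0
    rw [h1'] at h3
    rw [h3, orderOf_one] at h
    omega

end Order

/-! ### Internal points of a conic as traceless matrices up to sign -/

section Inner

theorem matrix_fin_two_ext {R : Type*} {A B : Matrix (Fin 2) (Fin 2) R} (h1 : A 0 0 = B 0 0)
    (h2 : A 0 1 = B 0 1) (h3 : A 1 0 = B 1 0) (h4 : A 1 1 = B 1 1) : A = B := by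
  ext i j
  fin_cases i <;> fin_cases j <;> assumption

variable {F : Type*} [Field F]

/-- Traceless matrices with determinant `-n`. If `n` is not a square, these are the vectors
representing the internal points of the conic of traceless matrices of determinant zero. -/
def IsInner (n : F) (X : Matrix (Fin 2) (Fin 2) F) : Prop :=
  X 1 1 = -X 0 0 ∧ X 0 0 ^ 2 + X 0 1 * X 1 0 = n

/-- The action of `SL(2, F)` on matrices by conjugation. -/
def slConj (h : Matrix.SpecialLinearGroup (Fin 2) F) (X : Matrix (Fin 2) (Fin 2) F) :
    Matrix (Fin 2) (Fin 2) F :=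
  h.1 * X * (h⁻¹).1

theorem slConj_one (X : Matrix (Fin 2) (Fin 2) F) : slConj 1 X = X := by
  simp [slConj]

theorem slConj_mul (g h : Matrix.SpecialLinearGroup (Fin 2) F) (X : Matrix (Fin 2) (Fin 2) F) :
    slConj (g * h) X = slConj g (slConj h X) := by
  simp only [slConj, _root_.mul_inv_rev, Matrix.SpecialLinearGroup.coe_mul, mul_assoc]

theorem slConj_neg (h : Matrix.SpecialLinearGroup (Fin 2) F) (X : Matrix (Fin 2) (Fin 2) F) :
    slConj h (-X) = -slConj h X := by
  simp [slConj]

theorem slConj_inv_slConj (h : Matrix.SpecialLinearGroup (Fin 2) F)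
    (X : Matrix (Fin 2) (Fin 2) F) : slConj h⁻¹ (slConj h X) = X := by
  rw [← slConj_mul, inv_mul_cancel, slConj_one]

theorem coe_inv_mul_coe (h : Matrix.SpecialLinearGroup (Fin 2) F) : (h⁻¹).1 * h.1 = 1 := by
  rw [← Matrix.SpecialLinearGroup.coe_mul, inv_mul_cancel, Matrix.SpecialLinearGroup.coe_one]

theorem coe_mul_coe_inv (h : Matrix.SpecialLinearGroup (Fin 2) F) : h.1 * (h⁻¹).1 = 1 := by
  rw [← Matrix.SpecialLinearGroup.coe_mul, mul_inv_cancel, Matrix.SpecialLinearGroup.coe_one]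

theorem slConj_mul_slConj (h : Matrix.SpecialLinearGroup (Fin 2) F)
    (X Y : Matrix (Fin 2) (Fin 2) F) : slConj h X * slConj h Y = slConj h (X * Y) := by
  simp only [slConj]
  calc h.1 * X * (h⁻¹).1 * (h.1 * Y * (h⁻¹).1) = h.1 * X * ((h⁻¹).1 * h.1) * Y * (h⁻¹).1 := by
        simp only [mul_assoc]
    _ = _ := by rw [coe_inv_mul_coe]; simp only [mul_assoc, one_mul]

theorem trace_slConj (h : Matrix.SpecialLinearGroup (Fin 2) F) (X : Matrix (Fin 2) (Fin 2) F) :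
    (slConj h X).trace = X.trace := by
  rw [slConj, Matrix.trace_mul_comm, ← mul_assoc, coe_inv_mul_coe, one_mul]

theorem isInner_iff {n : F} {X : Matrix (Fin 2) (Fin 2) F} :
    IsInner n X ↔ X.trace = 0 ∧ X.det = -n := by
  rw [IsInner, trace_fin_two, det_fin_two, ← add_eq_zero_iff_eq_neg, add_comm (X 1 1)]
  refine and_congr_right fun h => ?_
  replace h : X 1 1 = -X 0 0 := (neg_eq_of_add_eq_zero_right h).symm
  rw [h]
  constructor
  · intro h1; rw [← h1]; ring
  · intro h1; linear_combination -h1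

theorem IsInner.slConj {n : F} {X : Matrix (Fin 2) (Fin 2) F} (hX : IsInner n X)
    (h : Matrix.SpecialLinearGroup (Fin 2) F) : IsInner n (slConj h X) := by
  rw [isInner_iff] at hX ⊢
  refine ⟨by rw [trace_slConj, hX.1], ?_⟩
  rw [_root_.slConj, det_mul, det_mul, h.2, (h⁻¹).2, hX.2, one_mul, mul_one]

theorem IsInner.neg {n : F} {X : Matrix (Fin 2) (Fin 2) F} (hX : IsInner n X) :
    IsInner n (-X) := by
  obtain ⟨h1, h2⟩ := hX
  simp only [IsInner, Matrix.neg_apply, h1]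
  exact ⟨trivial, by rw [← h2]; ring⟩

theorem IsInner.upper_right_ne_zero {n : F} (hn : ¬ IsSquare n) {X : Matrix (Fin 2) (Fin 2) F}
    (hX : IsInner n X) : X 0 1 ≠ 0 := by
  intro h
  apply hn
  rw [← hX.2, h]
  exact ⟨X 0 0, by ring⟩

theorem IsInner.lower_left_ne_zero {n : F} (hn : ¬ IsSquare n) {X : Matrix (Fin 2) (Fin 2) F}
    (hX : IsInner n X) : X 1 0 ≠ 0 := by
  intro h
  apply hn
  rw [← hX.2, h]
  exact ⟨X 0 0, by ring⟩

theorem slConj_slDiag (t : Fˣ) (X : Matrix (Fin 2) (Fin 2) F) :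
    slConj (slDiag t) X = !![X 0 0, t ^ 2 * X 0 1; ((t⁻¹ : Fˣ) : F) ^ 2 * X 1 0, X 1 1] := by
  obtain ⟨i1, i2, i3, i4⟩ := sl_inv_apply (slDiag t)
  apply matrix_fin_two_ext <;>
    simp only [slConj, Matrix.mul_apply, Fin.sum_univ_two, i1, i2, i3, i4] <;> simp <;> field_simp

theorem slConj_slAnti (s : Fˣ) (X : Matrix (Fin 2) (Fin 2) F) :
    slConj (slAnti s) X = !![X 1 1, -(s ^ 2 * X 1 0); -(((s⁻¹ : Fˣ) : F) ^ 2 * X 0 1), X 0 0] := by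
  obtain ⟨i1, i2, i3, i4⟩ := sl_inv_apply (slAnti s)
  apply matrix_fin_two_ext <;>
    simp only [slConj, Matrix.mul_apply, Fin.sum_univ_two, i1, i2, i3, i4] <;> simp <;> field_simp

theorem slConj_slUpper (b : F) (X : Matrix (Fin 2) (Fin 2) F) :
    slConj (slUpper b) X = !![X 0 0 + b * X 1 0, X 0 1 + b * X 1 1 - b * (X 0 0 + b * X 1 0);
      X 1 0, X 1 1 - b * X 1 0] := by
  obtain ⟨i1, i2, i3, i4⟩ := sl_inv_apply (slUpper b)
  apply matrix_fin_two_ext <;>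
    simp only [slConj, Matrix.mul_apply, Fin.sum_univ_two, i1, i2, i3, i4] <;> simp <;> ring

theorem isSquare_mul_of_not_isSquare [Finite F] (h2 : (2 : F) ≠ 0) {a b : F} (ha : ¬ IsSquare a)
    (hb : ¬ IsSquare b) : IsSquare (a * b) := by
  have := Fintype.ofFinite F
  have hc : ringChar F ≠ 2 := fun h => h2 (by
    have := ringChar.Nat.cast_ringChar (R := F)
    rwa [h] at this)
  have ha0 : a ≠ 0 := fun h => ha (h ▸ IsSquare.zero)
  have hb0 : b ≠ 0 := fun h => hb (h ▸ IsSquare.zero)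
  rw [FiniteField.isSquare_iff hc ha0] at ha
  rw [FiniteField.isSquare_iff hc hb0] at hb
  rw [FiniteField.isSquare_iff hc (mul_ne_zero ha0 hb0), mul_pow,
    (FiniteField.pow_dichotomy hc ha0).resolve_left ha,
    (FiniteField.pow_dichotomy hc hb0).resolve_left hb]
  norm_num

/-- Equivalence up to sign under the conjugation action of `SL(2, F)`. -/
def SlEquiv (X Y : Matrix (Fin 2) (Fin 2) F) : Prop :=
  ∃ h, slConj h X = Y ∨ slConj h X = -Y

theorem SlEquiv.symm {X Y : Matrix (Fin 2) (Fin 2) F} (h : SlEquiv X Y) : SlEquiv Y X := by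
  obtain ⟨g, rfl | h⟩ := h
  · exact ⟨g⁻¹, Or.inl (slConj_inv_slConj _ _)⟩
  · refine ⟨g⁻¹, Or.inr ?_⟩
    rw [← neg_eq_iff_eq_neg] at h
    rw [← h, slConj_neg, slConj_inv_slConj]

theorem SlEquiv.trans {X Y Z : Matrix (Fin 2) (Fin 2) F} (h : SlEquiv X Y) (h' : SlEquiv Y Z) :
    SlEquiv X Z := by
  obtain ⟨g, h⟩ := h
  obtain ⟨g', h'⟩ := h'
  refine ⟨g' * g, ?_⟩
  rw [slConj_mul]
  rcases h with h | h <;> rcases h' with h' | h' <;> rw [h] <;> try rw [slConj_neg]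
  all_goals rw [h']; simp

/-- Any two traceless matrices with the same determinant `-n`, where `n` is not a square, are
conjugate under `SL(2, F)` up to sign. -/
theorem IsInner.slEquiv [Finite F] (h2 : (2 : F) ≠ 0) {n : F} (hn : ¬ IsSquare n)
    {X Y : Matrix (Fin 2) (Fin 2) F} (hX : IsInner n X) (hY : IsInner n Y) : SlEquiv X Y := by
  have hn0 : n ≠ 0 := fun h => hn (h ▸ IsSquare.zero)
  have normal_form : ∀ {Z : Matrix (Fin 2) (Fin 2) F}, IsInner n Z →
      SlEquiv Z !![0, n / Z 1 0; Z 1 0, 0] := by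
    intro Z hZ
    have hc := hZ.lower_left_ne_zero hn
    refine ⟨slUpper (-(Z 0 0 / Z 1 0)), Or.inl ?_⟩
    rw [slConj_slUpper, ← hZ.2, hZ.1]
    apply matrix_fin_two_ext <;> simp <;> field_simp <;> ring
  have sq_case : ∀ c d : F, c ≠ 0 → d ≠ 0 → IsSquare (c * d) →
      SlEquiv !![0, n / c; c, 0] !![0, n / d; d, 0] := by
    rintro c d hc hd ⟨r, hr⟩
    have hr0 : r ≠ 0 := by rintro rfl; rw [mul_zero] at hr; exact mul_ne_zero hc hd hr
    refine ⟨slDiag (Units.mk0 (c / r) (div_ne_zero hc hr0)), Or.inl ?_⟩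
    rw [slConj_slDiag]
    apply matrix_fin_two_ext <;> simp <;> field_simp
    · rw [hr]; ring
    · rw [pow_two, ← hr, mul_comm]
  refine (normal_form hX).trans (SlEquiv.trans ?_ (normal_form hY).symm)
  have hc := hX.lower_left_ne_zero hn
  have hd := hY.lower_left_ne_zero hn
  by_cases hs : IsSquare (X 1 0 * Y 1 0)
  · exact sq_case _ _ hc hd hs
  -- The antidiagonal element replaces the lower left entry c by n/c, up to sign. As n is a
  -- nonsquare, this changes the square class and reduces to `sq_case`.
  · refine SlEquiv.trans (Y := !![0, n / (n / X 1 0); n / X 1 0, 0]) ?_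
      (sq_case _ _ (div_ne_zero hn0 hc) hd ?_)
    · refine ⟨slAnti 1, Or.inr ?_⟩
      rw [slConj_slAnti]
      apply matrix_fin_two_ext <;> simp
      field_simp
    · have h1 := isSquare_mul_of_not_isSquare h2 hn hs
      obtain ⟨r, hr⟩ := h1
      refine ⟨r / X 1 0, ?_⟩
      field_simp
      rw [pow_two, ← hr]
      ring

/-- X is determined by an arbitrary X₀₀ and a nonzero X₀₁; the equation is then solved for X₁₀. -/
theorem natCard_isInner [Finite F] {n : F} (hn : ¬ IsSquare n) :
    Nat.card {X // IsInner n X} = Nat.card F * (Nat.card F - 1) := by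
  rw [← Nat.card_units, ← Nat.card_prod]
  refine Nat.card_congr ⟨fun X => (X.1 0 0, Units.mk0 (X.1 0 1) (X.2.upper_right_ne_zero hn)),
    fun p => ⟨!![p.1, p.2; (n - p.1 ^ 2) * ((p.2⁻¹ : Fˣ) : F), -p.1], ?_⟩, ?_, ?_⟩
  · simp only [IsInner]
    simp
    field_simp
    ring
  · rintro ⟨X, hX⟩
    have hb := hX.upper_right_ne_zero hn
    apply Subtype.ext
    apply matrix_fin_two_ext
    · simp
    · simp
    · simp only [← hX.2]; simp; field_simp
    · simp [hX.1]
  · rintro ⟨a, b⟩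
    ext <;> simp

end Inner

/-! ### Identifying the points of the design with internal points -/

/-- A map from a type of twice the size whose fibres are contained in the orbits of a fixed point
free involution is onto, and its fibres are these orbits. -/
theorem surjective_of_fibre_subset_pair {W P : Type*} [Finite W] [Finite P] (f : W → P) (ν : W → W)
    (hcard : Nat.card W = 2 * Nat.card P) (h : ∀ w w', f w = f w' → w' = w ∨ w' = ν w) :
    Function.Surjective f ∧ ∀ w, f (ν w) = f w := by
  classical
  have := Fintype.ofFinite W
  have := Fintype.ofFinite P
  have hle : ∀ x ∈ (Finset.univ : Finset P), (Finset.univ.filter fun w => f w = x).card ≤ 2 := by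
    intro x _
    rcases (Finset.univ.filter fun w => f w = x).eq_empty_or_nonempty with h0 | ⟨w, hw⟩
    · simp [h0]
    · refine (Finset.card_le_card (t := {w, ν w}) ?_).trans Finset.card_le_two
      intro w' hw'
      simp only [Finset.mem_filter, Finset.mem_univ, true_and] at hw hw'
      simpa using h w w' (hw.trans hw'.symm)
  have hsum : ∑ x : P, (Finset.univ.filter fun w => f w = x).card = ∑ _x : P, 2 := by
    rw [← Finset.card_eq_sum_card_fiberwise (f := f) (s := Finset.univ) (t := Finset.univ)
        (fun _ _ => Finset.mem_coe.2 (Finset.mem_univ _)),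
      Finset.card_univ, Finset.sum_const, Finset.card_univ, ← Nat.card_eq_fintype_card, hcard,
      Nat.card_eq_fintype_card, smul_eq_mul, mul_comm]
  -- The fibres have at most two elements each and 2|P| in total, so every fibre has exactly two.
  have heq := (Finset.sum_eq_sum_iff_of_le hle).1 hsum
  constructor
  · intro x
    have h1 := heq x (Finset.mem_univ _)
    obtain ⟨w, hw⟩ := Finset.card_pos.1 (by rw [h1]; exact two_pos)
    exact ⟨w, (Finset.mem_filter.1 hw).2⟩
  · intro w
    by_contra hne
    have h1 := heq (f w) (Finset.mem_univ _)
    have h3 : (Finset.univ.filter fun w' => f w' = f w) ⊆ {w} := by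
      intro w' hw'
      have h4 := (Finset.mem_filter.1 hw').2
      rcases h w w' h4.symm with rfl | rfl
      · simp
      · exact absurd h4 hne
    have := Finset.card_le_card h3
    rw [h1, Finset.card_singleton] at this
    omega

/-- The points of the design as internal points of a conic, in an equivariant way. -/
structure IsPointModel {F : Type*} [Field F] {P : Type*}
    (Φ : Matrix.SpecialLinearGroup (Fin 2) F →* Equiv.Perm P) (n : F)
    (pt : Matrix (Fin 2) (Fin 2) F → P) : Prop where
  not_isSquare : ¬ IsSquare n
  eq_iff : ∀ X Y, IsInner n X → IsInner n Y → (pt X = pt Y ↔ Y = X ∨ Y = -X)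
  surj : ∀ x, ∃ X, IsInner n X ∧ pt X = x
  equivariant : ∀ h X, IsInner n X → Φ h (pt X) = pt (slConj h X)
  rotation : ∀ X, IsInner n X → ∃ (M : Matrix.SpecialLinearGroup (Fin 2) F) (τ β : F),
    τ ≠ 0 ∧ β ≠ 0 ∧ M.1 = τ • (1 : Matrix (Fin 2) (Fin 2) F) + β • X

theorem slConj_smul_one_add {F : Type*} [Field F] (h : Matrix.SpecialLinearGroup (Fin 2) F)
    (τ β : F) (X : Matrix (Fin 2) (Fin 2) F) :
    slConj h (τ • 1 + β • X) = τ • 1 + β • slConj h X := by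
  simp only [slConj, mul_add, add_mul, Matrix.mul_smul, Matrix.smul_mul, mul_one, coe_mul_coe_inv]

/-- For a base point x₀ whose stabilizer has rotation M, let X₀ be the traceless part of M. Each h
fixing x₀ sends M to M or M⁻¹ up to sign, hence X₀ to ±X₀. So h x₀ ↦ ±h X₀ is well defined on the
orbit of x₀, and comparing cardinalities makes it a bijection defined on all points, without
assuming transitivity. -/
theorem IsDihedralAction.exists_isPointModel {F : Type*} [Field F] [Finite F] {P : Type*} {q : ℕ}
    {𝓑 : Set (Set P)} {G : Subgroup (Equiv.Perm P)}
    {Φ : Matrix.SpecialLinearGroup (Fin 2) F →* Equiv.Perm P} (hΦ : IsDihedralAction q 𝓑 G Φ)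
    (hq : Nat.card F = q) (hodd : Odd q) (h5 : 5 < q) (h2 : (2 : F) ≠ 0)
    (hP : Nat.card P = q * (q - 1) / 2) :
    ∃ n pt, IsPointModel Φ n pt := by
  classical
  have hP2 : q * (q - 1) = 2 * Nat.card P := by
    rw [hP, Nat.mul_div_cancel']
    obtain ⟨k, hk⟩ := hodd
    exact (Dvd.intro k (by omega : 2 * k = q - 1)).mul_left q
  have hpos : 0 < Nat.card P := by
    have : 0 < q * (q - 1) := Nat.mul_pos (by omega) (by omega)
    omega
  obtain ⟨⟨x₀⟩, hfin⟩ := Nat.card_pos_iff.1 hpos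
  obtain ⟨M, hord, hfix, hconj⟩ := hΦ.point x₀
  have htr := trace_ne_zero_of_two_lt_orderOf hΦ.map_eq_one (M := M) (by omega)
  set τ : F := (M 0 0 + M 1 1) / 2 with hτ
  have hτ0 : τ ≠ 0 := div_ne_zero htr h2
  set n : F := slDisc M / 4 with hn_def
  have h4 : (4 : F) ≠ 0 := by rw [show (4 : F) = 2 * 2 by norm_num]; exact mul_ne_zero h2 h2
  have hn : ¬ IsSquare n := fun h => not_isSquare_disc_of_orderOf hΦ.map_eq_one hq hodd h5 h2 hord
    ((isSquare_div_four_iff h2 _).1 h)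
  set X₀ : Matrix (Fin 2) (Fin 2) F := M.1 - τ • 1 with hX₀
  have hMX : M.1 = τ • 1 + (1 : F) • X₀ := by rw [hX₀, one_smul, add_sub_cancel]
  have hMX' : (M⁻¹).1 = τ • 1 + (-1 : F) • X₀ := by
    obtain ⟨i1, i2, i3, i4⟩ := sl_inv_apply M
    rw [hX₀, hτ]
    apply matrix_fin_two_ext <;> simp [i1, i2, i3, i4] <;> field_simp <;> ring
  have hinner : IsInner n X₀ := by
    have hd := sl_det M
    rw [IsInner, hX₀, hn_def, slDisc, hτ]
    constructor
    · simp; field_simp; ring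
    · simp; field_simp; linear_combination (-16 : F) * hd
  have hstab : ∀ h, Φ h x₀ = x₀ → slConj h X₀ = X₀ ∨ slConj h X₀ = -X₀ := by
    intro h hh
    have htX := (isInner_iff.1 hinner).1
    have key : ∀ ε : F, slConj h M.1 = τ • 1 + ε • X₀ ∨ slConj h M.1 = -(τ • 1 + ε • X₀) →
        slConj h X₀ = ε • X₀ := by
      intro ε hε
      rw [hMX, slConj_smul_one_add] at hε
      rcases hε with hε | hε
      · have h1 := add_left_cancel hε
        rwa [one_smul] at h1
      -- The ambiguity of sign in lifting from PSL to SL is removed by the trace: it would give 4τ =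
      -- 0.
      · exfalso
        have h1 := congrArg Matrix.trace hε
        simp only [Matrix.trace_add, Matrix.trace_smul, Matrix.trace_neg, trace_slConj, htX,
          Matrix.trace_one, Fintype.card_fin, smul_eq_mul, mul_zero, add_zero] at h1
        have h6 : τ * (2 * 2) = 0 := by push_cast at h1; linear_combination h1
        exact mul_ne_zero hτ0 (mul_ne_zero h2 h2) h6
    have hcoe : slConj h M.1 = (h * M * h⁻¹).1 := by simp [slConj]
    have hneg : ∀ A : Matrix.SpecialLinearGroup (Fin 2) F, (-A).1 = -A.1 :=
      Matrix.SpecialLinearGroup.coe_neg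
    rcases hconj h hh with h1 | h1 <;> rw [map_eq_map_iff hΦ.map_eq_one] at h1
    · left
      have := key 1 (by
        rcases h1 with h1 | h1
        · left; rw [hcoe, h1]; exact hMX
        · right; rw [hcoe, h1, hneg]; exact congrArg _ hMX)
      rwa [one_smul] at this
    · right
      have := key (-1) (by
        rcases h1 with h1 | h1
        · left; rw [hcoe, h1]; exact hMX'
        · right; rw [hcoe, h1, hneg]; exact congrArg _ hMX')
      rwa [neg_smul, one_smul] at this
  have hex : ∀ X, ∃ h, IsInner n X → slConj h X₀ = X ∨ slConj h X₀ = -X := by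
    intro X
    by_cases hX : IsInner n X
    · obtain ⟨h, hh⟩ := hinner.slEquiv h2 hn hX
      exact ⟨h, fun _ => hh⟩
    · exact ⟨1, fun h => absurd h hX⟩
  choose H hH using hex
  -- `H X` is a chosen element carrying X₀ to ±X; outside the internal vectors the value of `pt` is
  -- irrelevant.
  set pt : Matrix (Fin 2) (Fin 2) F → P := fun X => Φ (H X) x₀ with hpt
  have hmove : ∀ h h' : Matrix.SpecialLinearGroup (Fin 2) F, Φ h x₀ = Φ h' x₀ →
      slConj h' X₀ = slConj h X₀ ∨ slConj h' X₀ = -slConj h X₀ := by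
    intro h h' hh
    have h1 : Φ (h⁻¹ * h') x₀ = x₀ := by
      rw [map_mul, Equiv.Perm.mul_apply, ← hh, map_inv, ← Equiv.Perm.mul_apply, inv_mul_cancel,
        Equiv.Perm.one_apply]
    have h3 : slConj h' X₀ = slConj h (slConj (h⁻¹ * h') X₀) := by
      rw [← slConj_mul, mul_inv_cancel_left]
    rcases hstab _ h1 with h6 | h6
    · left; rw [h3, h6]
    · right; rw [h3, h6, slConj_neg]
  have hsign : ∀ {A B C D : Matrix (Fin 2) (Fin 2) F}, (A = C ∨ A = -C) → (B = D ∨ B = -D) →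
      (A = B ∨ A = -B) → C = D ∨ C = -D := by
    rintro A B C D (rfl | rfl) (rfl | rfl) (h | h) <;>
      first
      | exact Or.inl h
      | exact Or.inr h
      | exact Or.inl (neg_inj.1 h)
      | exact Or.inr (neg_eq_iff_eq_neg.1 h)
      | exact Or.inl (by rwa [neg_neg] at h)
      | exact Or.inr (by rwa [neg_neg, neg_eq_iff_eq_neg] at h)
  have hfib : ∀ X Y, IsInner n X → IsInner n Y → pt X = pt Y → Y = X ∨ Y = -X := by
    intro X Y hX hY hXY
    exact hsign (hH Y hY) (hH X hX) (hmove _ _ hXY)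
  have hcardW : Nat.card {X // IsInner n X} = 2 * Nat.card P := by
    rw [natCard_isInner hn, hq, hP2]
  -- The stabilizer argument only shows that fibres of `pt` lie in pairs ±X. That X and -X do give
  -- the same point, and that all points occur, comes from |W| = q(q-1) = 2|P|.
  obtain ⟨hs, hν⟩ := surjective_of_fibre_subset_pair
    (fun X : {X // IsInner n X} => pt X.1) (fun X => ⟨-X.1, X.2.neg⟩) hcardW (by
      intro w w' h
      rcases hfib _ _ w.2 w'.2 h with h1 | h1
      · left; exact Subtype.ext h1
      · right; exact Subtype.ext h1)
  refine ⟨n, pt, hn, ?_, ?_, ?_, ?_⟩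
  · intro X Y hX hY
    refine ⟨hfib X Y hX hY, ?_⟩
    rintro (rfl | rfl)
    · rfl
    · exact (hν ⟨X, hX⟩).symm
  · intro x
    obtain ⟨X, hX⟩ := hs x
    exact ⟨X.1, X.2, hX⟩
  · intro h X hX
    obtain ⟨Y, hY⟩ := hs (Φ h (pt X))
    have h1 : Φ (h * H X) x₀ = Φ (H Y.1) x₀ := by
      rw [map_mul, Equiv.Perm.mul_apply]; exact hY.symm
    have h3 := hmove _ _ h1
    rw [slConj_mul] at h3
    have h6 : slConj h (slConj (H X) X₀) = slConj h X ∨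
        slConj h (slConj (H X) X₀) = -slConj h X := by
      rcases hH X hX with h7 | h7
      · left; rw [h7]
      · right; rw [h7, slConj_neg]
    have h7 := hsign (hH Y.1 Y.2) h6 h3
    rw [← hY]
    change pt Y.1 = _
    rcases h7 with h8 | h8
    · rw [h8]
    · rw [h8]
      exact hν ⟨_, hX.slConj h⟩
  · intro X hX
    have hc : (H X * M * (H X)⁻¹).1 = τ • 1 + (1 : F) • slConj (H X) X₀ := by
      rw [← slConj_smul_one_add, ← hMX, slConj, Matrix.SpecialLinearGroup.coe_mul,
        Matrix.SpecialLinearGroup.coe_mul]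
    rcases hH X hX with h1 | h1
    · exact ⟨H X * M * (H X)⁻¹, τ, 1, hτ0, one_ne_zero, by rw [hc, h1]⟩
    · exact ⟨H X * M * (H X)⁻¹, τ, -1, hτ0, neg_ne_zero.2 one_ne_zero, by
        rw [hc, h1, smul_neg, neg_smul]⟩

/-! ### The norm form of the quadratic extension, and vectors with prescribed trace product -/

section NormForm

variable {F : Type*} [Field F]

theorem norm_form_eq_zero {n : F} (hn : ¬ IsSquare n) {x y : F} (h : x ^ 2 - n * y ^ 2 = 0) :
    x = 0 ∧ y = 0 := by
  by_cases hy : y = 0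
  · subst hy
    simpa using h
  · exfalso
    apply hn
    refine ⟨x / y, ?_⟩
    field_simp
    linear_combination -h

theorem trace_mul_fin_two (X Y : Matrix (Fin 2) (Fin 2) F) :
    (X * Y).trace = X 0 0 * Y 0 0 + X 0 1 * Y 1 0 + (X 1 0 * Y 0 1 + X 1 1 * Y 1 1) := by
  simp [Matrix.trace_fin_two, Matrix.mul_apply, Fin.sum_univ_two]

/-- Y - X is orthogonal to X and isotropic for the trace form, while the orthogonal complement of X
among traceless matrices is anisotropic, being a copy of the norm form x² - ny². -/
theorem IsInner.eq_of_trace_mul {n : F} (hn : ¬ IsSquare n)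
    {X Y : Matrix (Fin 2) (Fin 2) F} (hX : IsInner n X) (hY : IsInner n Y)
    (h : (X * Y).trace = 2 * n) : Y = X := by
  have hb := hX.upper_right_ne_zero hn
  obtain ⟨hX1, hX2⟩ := hX
  obtain ⟨hY1, hY2⟩ := hY
  rw [trace_mul_fin_two, hX1, hY1] at h
  have hc : Y 1 0 = (2 * n - 2 * X 0 0 * Y 0 0 - X 1 0 * Y 0 1) / X 0 1 := by
    rw [eq_div_iff hb]; linear_combination h
  have hcX : X 1 0 = (n - X 0 0 ^ 2) / X 0 1 := by rw [eq_div_iff hb]; linear_combination hX2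
  -- These are coordinates of Y - X in the complement of X, scaled by X₀₁; eliminating X₁₀ and Y₁₀
  -- turns the condition on Y into a norm equation.
  have h3 := norm_form_eq_zero hn (x := Y 0 0 * X 0 1 - X 0 0 * Y 0 1) (y := Y 0 1 - X 0 1) (by
    rw [hc, hcX] at hY2
    field_simp at hY2
    linear_combination hY2)
  have hy : Y 0 1 = X 0 1 := sub_eq_zero.1 h3.2
  have hx : Y 0 0 = X 0 0 := by
    have h5 := h3.1
    rw [hy, ← sub_mul] at h5
    exact sub_eq_zero.1 ((mul_eq_zero.1 h5).resolve_right hb)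
  apply matrix_fin_two_ext hx hy _ (by rw [hY1, hX1, hx])
  apply mul_left_cancel₀ hb
  rw [hx, hy] at hY2
  linear_combination hY2 - hX2

variable [Finite F]

theorem exists_norm_form_eq (h2 : (2 : F) ≠ 0) {n : F} (hn : n ≠ 0) (k : F) :
    ∃ u v : F, u ^ 2 - n * v ^ 2 = k := by
  classical
  have := Fintype.ofFinite F
  have hc : ringChar F ≠ 2 := fun h => h2 (by
    have := ringChar.Nat.cast_ringChar (R := F)
    rwa [h] at this)
  have hf : (Polynomial.X ^ 2 - Polynomial.C k : Polynomial F).degree = 2 :=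
    Polynomial.degree_X_pow_sub_C two_pos k
  have hg : (Polynomial.C (-n) * Polynomial.X ^ 2 : Polynomial F).degree = 2 :=
    Polynomial.degree_C_mul_X_pow 2 (neg_ne_zero.2 hn)
  obtain ⟨u, v, h⟩ := FiniteField.exists_root_sum_quadratic hf hg
    (FiniteField.odd_card_of_char_ne_two hc)
  refine ⟨u, v, ?_⟩
  simp at h
  linear_combination h

/-- The number of elements of given nonzero norm in a quadratic extension of a finite field. -/
theorem natCard_norm_form (h2 : (2 : F) ≠ 0) {n : F} (hn : ¬ IsSquare n) {k : F} (hk : k ≠ 0) :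
    Nat.card {p : F × F // p.1 ^ 2 - n * p.2 ^ 2 = k} = Nat.card F + 1 := by
  classical
  have := Fintype.ofFinite F
  have hn0 : n ≠ 0 := fun h => hn (h ▸ IsSquare.zero)
  have hle : ∀ k k' : F, k ≠ 0 → k' ≠ 0 → Nat.card {p : F × F // p.1 ^ 2 - n * p.2 ^ 2 = k} ≤
      Nat.card {p : F × F // p.1 ^ 2 - n * p.2 ^ 2 = k'} := by
    intro k k' hk hk'
    -- Multiplication by u + v√n, of norm k'/k, injects the elements of norm k into those of norm
    -- k'. All nonzero norms are therefore equally frequent, and q² = 1 + (q-1)N.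
    obtain ⟨u, v, huv⟩ := exists_norm_form_eq h2 hn0 (k' / k)
    have huv0 : u ^ 2 - n * v ^ 2 ≠ 0 := by rw [huv]; exact div_ne_zero hk' hk
    refine Nat.card_le_card_of_injective
      (fun p => ⟨(u * p.1.1 + n * v * p.1.2, u * p.1.2 + v * p.1.1), ?_⟩) ?_
    · have h1 := p.2
      rw [eq_div_iff hk, ← h1] at huv
      rw [← huv]
      ring
    · rintro ⟨⟨x, y⟩, h⟩ ⟨⟨x', y'⟩, h'⟩ hp
      simp only [Subtype.mk.injEq, Prod.mk.injEq] at hp ⊢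
      obtain ⟨e1, e2⟩ := hp
      constructor
      · apply mul_left_cancel₀ huv0
        linear_combination u * e1 - n * v * e2
      · apply mul_left_cancel₀ huv0
        linear_combination u * e2 - v * e1
  have heq : ∀ k' : F, k' ≠ 0 → Nat.card {p : F × F // p.1 ^ 2 - n * p.2 ^ 2 = k'} =
      Nat.card {p : F × F // p.1 ^ 2 - n * p.2 ^ 2 = k} :=
    fun k' hk' => le_antisymm (hle _ _ hk' hk) (hle _ _ hk hk')
  have h0 : Nat.card {p : F × F // p.1 ^ 2 - n * p.2 ^ 2 = 0} = 1 := by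
    rw [Nat.card_eq_one_iff_unique]
    refine ⟨⟨?_⟩, ⟨⟨(0, 0), by simp⟩⟩⟩
    rintro ⟨⟨x, y⟩, h⟩ ⟨⟨x', y'⟩, h'⟩
    obtain ⟨rfl, rfl⟩ := norm_form_eq_zero hn h
    obtain ⟨rfl, rfl⟩ := norm_form_eq_zero hn h'
    rfl
  have hsum : ∑ k' : F, Nat.card {p : F × F // p.1 ^ 2 - n * p.2 ^ 2 = k'} =
      Nat.card F * Nat.card F := by
    rw [← Nat.card_prod, ← Nat.card_sigma]
    exact Nat.card_congr (Equiv.sigmaFiberEquiv fun p : F × F => p.1 ^ 2 - n * p.2 ^ 2)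
  rw [← Finset.add_sum_erase _ _ (Finset.mem_univ (0 : F)), h0,
    Finset.sum_congr rfl (fun k' hk' => heq k' (Finset.ne_of_mem_erase hk')), Finset.sum_const,
    Finset.card_erase_of_mem (Finset.mem_univ _), Finset.card_univ, ← Nat.card_eq_fintype_card,
    smul_eq_mul] at hsum
  have hF : 1 < Nat.card F := Finite.one_lt_card
  obtain ⟨m, hm⟩ : ∃ m, Nat.card F = m + 2 := ⟨Nat.card F - 2, by omega⟩
  rw [hm] at hsum ⊢
  rw [show m + 2 - 1 = m + 1 by omega] at hsum
  apply Nat.eq_of_mul_eq_mul_left (Nat.succ_pos m)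
  simp only [Nat.succ_eq_add_one]
  linarith

/-- Write Y = (e/2n)X + Z with Z orthogonal to X. Then Z² = n - e²/(4n), which is nonzero exactly
because e ≠ ±2n, and on the complement of X the square is the norm form in x = Z₀₀ - X₀₀Z₀₁/X₀₁ and
y = Z₀₁/X₀₁. -/
theorem natCard_isInner_trace (h2 : (2 : F) ≠ 0) {n : F} (hn : ¬ IsSquare n)
    {X : Matrix (Fin 2) (Fin 2) F} (hX : IsInner n X) {e : F} (he : e ≠ 2 * n)
    (he' : e ≠ -(2 * n)) :
    Nat.card {Y // IsInner n Y ∧ (X * Y).trace = e} = Nat.card F + 1 := by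
  have hn0 : n ≠ 0 := fun h => hn (h ▸ IsSquare.zero)
  have hb := hX.upper_right_ne_zero hn
  have hk : n - e ^ 2 / (4 * n) ≠ 0 := by
    intro h
    have h4 : (4 : F) ≠ 0 := by rw [show (4 : F) = 2 * 2 by norm_num]; exact mul_ne_zero h2 h2
    field_simp at h
    have h1 : (e - 2 * n) * (e + 2 * n) = 0 := by linear_combination -h
    rcases mul_eq_zero.1 h1 with h3 | h3
    · exact he (sub_eq_zero.1 h3)
    · exact he' (eq_neg_of_add_eq_zero_left h3)
  rw [← natCard_norm_form h2 hn hk]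
  have h4 : (4 : F) ≠ 0 := by rw [show (4 : F) = 2 * 2 by norm_num]; exact mul_ne_zero h2 h2
  have hX2 := hX.2
  refine Nat.card_congr ⟨fun Y => ⟨(Y.1 0 0 - X 0 0 * Y.1 0 1 / X 0 1,
    Y.1 0 1 / X 0 1 - e / (2 * n)), ?_⟩, fun p => ⟨!![p.1.1 + X 0 0 * (p.1.2 + e / (2 * n)),
      X 0 1 * (p.1.2 + e / (2 * n));
      (e - 2 * X 0 0 * (p.1.1 + X 0 0 * (p.1.2 + e / (2 * n))) -
        X 1 0 * (X 0 1 * (p.1.2 + e / (2 * n)))) / X 0 1,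
      -(p.1.1 + X 0 0 * (p.1.2 + e / (2 * n)))], ?_⟩, ?_, ?_⟩
  · obtain ⟨Y, ⟨hY1, hY2⟩, hY3⟩ := Y
    rw [trace_mul_fin_two, hX.1, hY1] at hY3
    have hc : Y 1 0 = (e - 2 * X 0 0 * Y 0 0 - X 1 0 * Y 0 1) / X 0 1 := by
      rw [eq_div_iff hb]; linear_combination hY3
    rw [hc] at hY2
    have hcX : X 1 0 = (n - X 0 0 ^ 2) / X 0 1 := by rw [eq_div_iff hb]; linear_combination hX2
    rw [hcX] at hY2
    simp only
    field_simp at hY2 ⊢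
    linear_combination (16 * n) * hY2
  · obtain ⟨⟨x, y⟩, hp⟩ := p
    have hcX : X 1 0 = (n - X 0 0 ^ 2) / X 0 1 := by rw [eq_div_iff hb]; linear_combination hX2
    simp only at hp
    refine ⟨⟨?_, ?_⟩, ?_⟩
    · simp
    · simp [hcX]
      field_simp at hp ⊢
      linear_combination n * hp
    · rw [trace_mul_fin_two, hX.1]
      simp
      field_simp
      ring
  · rintro ⟨Y, ⟨hY1, hY2⟩, hY3⟩
    apply Subtype.ext
    rw [trace_mul_fin_two, hX.1, hY1] at hY3
    apply matrix_fin_two_ext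
    · simp; field_simp; ring
    · simp; field_simp
    · simp; field_simp; linear_combination -(X 0 1) * hY3
    · simp [hY1]; field_simp; ring
  · rintro ⟨⟨x, y⟩, hp⟩
    apply Subtype.ext
    ext
    · simp; field_simp; ring
    · simp; field_simp; ring

end NormForm

/-! ### The distribution of the trace form on a block -/

section Counting

variable {F : Type*} [Field F] {P : Type*} {n : F}

theorem IsInner.neg_ne_self (h2 : (2 : F) ≠ 0) (hn : ¬ IsSquare n) {X : Matrix (Fin 2) (Fin 2) F}
    (hX : IsInner n X) : -X ≠ X := by
  intro h
  have h1 := congrFun (congrFun h 0) 1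
  rw [Matrix.neg_apply] at h1
  have h3 : 2 * X 0 1 = 0 := by linear_combination -h1
  exact (mul_ne_zero h2 (hX.upper_right_ne_zero hn)) h3

theorem trace_mul_self_of_isInner {X : Matrix (Fin 2) (Fin 2) F} (hX : IsInner n X) :
    (X * X).trace = 2 * n := by
  rw [trace_mul_fin_two, hX.1, ← hX.2]; ring

variable [Finite F]

/-- The vectors representing the points of a block. -/
noncomputable def blockVectors (n : F) (pt : Matrix (Fin 2) (Fin 2) F → P) (B : Set P) :
    Finset (Matrix (Fin 2) (Fin 2) F) :=
  (Set.toFinite {X | IsInner n X ∧ pt X ∈ B}).toFinset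

theorem mem_blockVectors {n : F} {pt : Matrix (Fin 2) (Fin 2) F → P} {B : Set P}
    {X : Matrix (Fin 2) (Fin 2) F} : X ∈ blockVectors n pt B ↔ IsInner n X ∧ pt X ∈ B := by
  simp [blockVectors]

open Classical in
/-- The number of pairs of vectors in a block with a given value of the trace form. -/
noncomputable def blockPairs (n : F) (pt : Matrix (Fin 2) (Fin 2) F → P) (B : Set P) (e : F) :
    Finset (Matrix (Fin 2) (Fin 2) F × Matrix (Fin 2) (Fin 2) F) :=
  (blockVectors n pt B ×ˢ blockVectors n pt B).filter fun p => (p.1 * p.2).trace = e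

theorem mem_blockPairs {n : F} {pt : Matrix (Fin 2) (Fin 2) F → P} {B : Set P} {e : F}
    {p : Matrix (Fin 2) (Fin 2) F × Matrix (Fin 2) (Fin 2) F} : p ∈ blockPairs n pt B e ↔
      (p.1 ∈ blockVectors n pt B ∧ p.2 ∈ blockVectors n pt B) ∧ (p.1 * p.2).trace = e := by
  simp [blockPairs]

variable {Φ : Matrix.SpecialLinearGroup (Fin 2) F →* Equiv.Perm P}
  {pt : Matrix (Fin 2) (Fin 2) F → P}

theorem IsPointModel.neg_mem_blockVectors (hpt : IsPointModel Φ n pt) {B : Set P}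
    {X : Matrix (Fin 2) (Fin 2) F} (hX : X ∈ blockVectors n pt B) : -X ∈ blockVectors n pt B := by
  rw [mem_blockVectors] at hX ⊢
  refine ⟨hX.1.neg, ?_⟩
  rw [← (hpt.eq_iff X (-X) hX.1 hX.1.neg).2 (Or.inr rfl)]
  exact hX.2

theorem IsPointModel.slConj_mem_blockVectors (hpt : IsPointModel Φ n pt) {B : Set P}
    (M : Matrix.SpecialLinearGroup (Fin 2) F) {X : Matrix (Fin 2) (Fin 2) F}
    (hX : X ∈ blockVectors n pt B) : slConj M X ∈ blockVectors n pt (Φ M • B) := by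
  rw [mem_blockVectors] at hX ⊢
  refine ⟨hX.1.slConj M, ?_⟩
  rw [← hpt.equivariant M X hX.1]
  exact Set.smul_mem_smul_set hX.2

theorem IsPointModel.card_blockVectors [Finite P] (hpt : IsPointModel Φ n pt)
    (h2 : (2 : F) ≠ 0) (B : Set P) : (blockVectors n pt B).card = 2 * B.ncard := by
  classical
  rw [Finset.card_eq_sum_card_fiberwise (f := pt) (t := (Set.toFinite B).toFinset)
    (fun X hX => by simpa using (mem_blockVectors.1 hX).2)]
  rw [Finset.sum_congr rfl (g := fun _ => 2), Finset.sum_const, smul_eq_mul, mul_comm,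
    Set.ncard_eq_toFinset_card B]
  intro x hx
  obtain ⟨X, hX, rfl⟩ := hpt.surj x
  have hx' : pt X ∈ B := by simpa using hx
  rw [show (blockVectors n pt B).filter (fun Y => pt Y = pt X) = {X, -X} by
    ext Y
    simp only [Finset.mem_filter, mem_blockVectors, Finset.mem_insert, Finset.mem_singleton]
    constructor
    · rintro ⟨⟨hY, _⟩, h⟩
      exact (hpt.eq_iff X Y hX hY).1 h.symm
    · intro h
      have hY : IsInner n Y := by
        rcases h with rfl | rfl
        · exact hX
        · exact hX.neg
      have h1 := (hpt.eq_iff X Y hX hY).2 h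
      exact ⟨⟨hY, h1 ▸ hx'⟩, h1.symm⟩]
  exact Finset.card_pair (hX.neg_ne_self h2 hpt.not_isSquare).symm

theorem IsPointModel.card_blockPairs_smul (hpt : IsPointModel Φ n pt) (B : Set P) (e : F)
    (M : Matrix.SpecialLinearGroup (Fin 2) F) :
    (blockPairs n pt (Φ M • B) e).card = (blockPairs n pt B e).card := by
  have hle : ∀ (C : Set P) (N : Matrix.SpecialLinearGroup (Fin 2) F),
      (blockPairs n pt C e).card ≤ (blockPairs n pt (Φ N • C) e).card := by
    intro C N
    refine Finset.card_le_card_of_injOn (fun p => (slConj N p.1, slConj N p.2)) ?_ ?_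
    · intro p hp
      have hp' := mem_blockPairs.1 hp
      refine mem_blockPairs.2 ⟨⟨hpt.slConj_mem_blockVectors N hp'.1.1,
        hpt.slConj_mem_blockVectors N hp'.1.2⟩, ?_⟩
      rw [slConj_mul_slConj, trace_slConj]
      exact hp'.2
    · rintro ⟨X, Y⟩ - ⟨X', Y'⟩ - h
      have h1 := congrArg (fun p => (slConj N⁻¹ p.1, slConj N⁻¹ p.2)) h
      simpa only [slConj_inv_slConj] using h1
  refine le_antisymm ?_ (hle B M)
  have h1 := hle (Φ M • B) M⁻¹
  rwa [map_inv, inv_smul_smul] at h1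

theorem IsPointModel.card_blockPairs_two_mul [Finite P] (hpt : IsPointModel Φ n pt)
    (h2 : (2 : F) ≠ 0) (B : Set P) : (blockPairs n pt B (2 * n)).card = 2 * B.ncard := by
  rw [← hpt.card_blockVectors h2]
  refine Finset.card_nbij' Prod.fst (fun X => (X, X)) ?_ ?_ ?_ ?_
  · intro p hp; exact (mem_blockPairs.1 hp).1.1
  · intro X hX
    exact mem_blockPairs.2 ⟨⟨hX, hX⟩, trace_mul_self_of_isInner (mem_blockVectors.1 hX).1⟩
  · rintro ⟨X, Y⟩ hp
    obtain ⟨⟨h1, h3⟩, h4⟩ := mem_blockPairs.1 hp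
    have := (mem_blockVectors.1 h1).1.eq_of_trace_mul hpt.not_isSquare (mem_blockVectors.1 h3).1 h4
    rw [show Y = X from this]
  · intro X _; rfl

theorem IsPointModel.card_blockPairs_neg (hpt : IsPointModel Φ n pt) (B : Set P) (e : F) :
    (blockPairs n pt B (-e)).card = (blockPairs n pt B e).card := by
  refine Finset.card_nbij' (fun p => (p.1, -p.2)) (fun p => (p.1, -p.2)) ?_ ?_ ?_ ?_
  · intro p hp
    obtain ⟨⟨h1, h3⟩, h4⟩ := mem_blockPairs.1 hp
    exact mem_blockPairs.2 ⟨⟨h1, hpt.neg_mem_blockVectors h3⟩, by simp [h4]⟩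
  · intro p hp
    obtain ⟨⟨h1, h3⟩, h4⟩ := mem_blockPairs.1 hp
    exact mem_blockPairs.2 ⟨⟨h1, hpt.neg_mem_blockVectors h3⟩, by simp [h4]⟩
  · intro p _; simp
  · intro p _; simp

/-- Double counting of blocks against pairs of vectors with trace product e. There are q(q-1)(q+1)
such pairs; as e ≠ ±2n they represent distinct points, so each lies in two blocks; and block
transitivity makes all blocks contribute equally. -/
theorem IsPointModel.card_blockPairs [Finite P] (hpt : IsPointModel Φ n pt)
    (h2 : (2 : F) ≠ 0) {𝓑 : Set (Set P)}
    (htrans : ∀ B ∈ 𝓑, ∀ C ∈ 𝓑, ∃ M, Φ M • B = C)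
    (hpair : ∀ x y : P, x ≠ y → {B ∈ 𝓑 | x ∈ B ∧ y ∈ B}.ncard = 2) {B : Set P} (hB : B ∈ 𝓑)
    {e : F} (he : e ≠ 2 * n) (he' : e ≠ -(2 * n)) :
    𝓑.ncard * (blockPairs n pt B e).card =
      2 * (Nat.card F * (Nat.card F - 1) * (Nat.card F + 1)) := by
  classical
  have h𝓑 : 𝓑.Finite := Set.toFinite _
  have hW : (blockVectors n pt Set.univ).card = Nat.card F * (Nat.card F - 1) := by
    rw [← natCard_isInner hpt.not_isSquare]
    exact (Nat.subtype_card _ fun X => by simp [mem_blockVectors]).symm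
  have key := Finset.sum_card_bipartiteAbove_eq_sum_card_bipartiteBelow
    (s := h𝓑.toFinset) (t := blockPairs n pt Set.univ e)
    (fun C p => pt p.1 ∈ C ∧ pt p.2 ∈ C)
  have hl : ∀ C ∈ h𝓑.toFinset, ((blockPairs n pt Set.univ e).bipartiteAbove
      (fun C p => pt p.1 ∈ C ∧ pt p.2 ∈ C) C).card = (blockPairs n pt B e).card := by
    intro C hC
    obtain ⟨M, rfl⟩ := htrans B hB C (by simpa using hC)
    rw [← hpt.card_blockPairs_smul B e M]
    congr 1
    ext p
    simp only [Finset.mem_bipartiteAbove, mem_blockPairs, mem_blockVectors, Set.mem_univ, and_true]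
    tauto
  have hr : ∀ p ∈ blockPairs n pt Set.univ e, (h𝓑.toFinset.bipartiteBelow
      (fun C p => pt p.1 ∈ C ∧ pt p.2 ∈ C) p).card = 2 := by
    intro p hp
    obtain ⟨⟨h1, h3⟩, h4⟩ := mem_blockPairs.1 hp
    rw [mem_blockVectors] at h1 h3
    have hne : pt p.1 ≠ pt p.2 := by
      intro h
      rcases (hpt.eq_iff _ _ h1.1 h3.1).1 h with h5 | h5
      · rw [h5, trace_mul_self_of_isInner h1.1] at h4
        exact he h4.symm
      · rw [h5, mul_neg, Matrix.trace_neg, trace_mul_self_of_isInner h1.1] at h4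
        exact he' h4.symm
    refine Eq.trans ?_ (hpair _ _ hne)
    rw [Set.ncard_eq_toFinset_card _ (Set.toFinite _)]
    congr 1
    ext C
    simp only [Finset.mem_bipartiteBelow, Set.Finite.mem_toFinset, Set.mem_ofPred_eq]
  rw [Finset.sum_congr rfl hl, Finset.sum_congr rfl hr, Finset.sum_const, Finset.sum_const,
    smul_eq_mul, smul_eq_mul, ← Set.ncard_eq_toFinset_card] at key
  rw [key, mul_comm, ← hW]
  congr 1
  rw [Finset.card_eq_sum_card_fiberwise (f := Prod.fst) (t := blockVectors n pt Set.univ)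
    (fun p hp => (mem_blockPairs.1 hp).1.1), Finset.sum_congr rfl (g := fun _ => Nat.card F + 1),
    Finset.sum_const, smul_eq_mul]
  intro X hX
  have hX' := (mem_blockVectors.1 hX).1
  rw [← natCard_isInner_trace h2 hpt.not_isSquare hX' he he',
    Nat.subtype_card (Set.toFinite {Y | IsInner n Y ∧ (X * Y).trace = e}).toFinset (by simp)]
  refine Finset.card_nbij' Prod.snd (fun Y => (X, Y)) ?_ ?_ ?_ ?_
  · intro p hp
    obtain ⟨hp1, rfl⟩ := Finset.mem_filter.1 hp
    obtain ⟨⟨-, h3⟩, h4⟩ := mem_blockPairs.1 hp1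
    simpa using ⟨(mem_blockVectors.1 h3).1, h4⟩
  · intro Y hY
    obtain ⟨h3, h4⟩ : IsInner n Y ∧ (X * Y).trace = e := by simpa using hY
    exact Finset.mem_filter.2
      ⟨mem_blockPairs.2 ⟨⟨hX, mem_blockVectors.2 ⟨h3, Set.mem_univ _⟩⟩, h4⟩, rfl⟩
  · rintro p hp
    obtain ⟨-, rfl⟩ := Finset.mem_filter.1 hp
    rfl
  · intro Y _
    rfl

/-- The value e has multiplicity 4(q-1), except that ±2n have multiplicity 2(q-1), since tr(XY) =
±2n forces Y = ±X. The ring `R` is left free so as to serve both for counting over ℤ and for power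
sums over `F`. -/
theorem IsPointModel.sum_trace [Finite P] [Fintype F] (hpt : IsPointModel Φ n pt)
    (h2 : (2 : F) ≠ 0) {q : ℕ} (hq : Nat.card F = q) (hodd : Odd q) {𝓑 : Set (Set P)}
    (htrans : ∀ B ∈ 𝓑, ∀ C ∈ 𝓑, ∃ M, Φ M • B = C)
    (hpair : ∀ x y : P, x ≠ y → {B ∈ 𝓑 | x ∈ B ∧ y ∈ B}.ncard = 2)
    (hcard : 𝓑.ncard = q * (q + 1) / 2) {B : Set P} (hB : B ∈ 𝓑) (hBc : B.ncard = q - 1)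
    {R : Type*} [CommRing R] (f : F → R) :
    ∑ X ∈ blockVectors n pt B, ∑ Y ∈ blockVectors n pt B, f (X * Y).trace =
      4 * (q - 1) * ∑ e, f e - 2 * (q - 1) * (f (2 * n) + f (-(2 * n))) := by
  classical
  have hn0 : n ≠ 0 := fun h => hpt.not_isSquare (h ▸ IsSquare.zero)
  have hne : 2 * n ≠ -(2 * n) := by
    intro h
    have h1 : 2 * (2 * n) = 0 := by linear_combination h
    exact mul_ne_zero h2 (mul_ne_zero h2 hn0) h1
  obtain ⟨k, hk⟩ := hodd
  have hc : ∀ e : F, ((blockPairs n pt B e).card : R) = 4 * (q - 1) -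
      ((if e = 2 * n then 2 * ((q : R) - 1) else 0) +
        (if e = -(2 * n) then 2 * ((q : R) - 1) else 0)) := by
    intro e
    have hq1 : ((2 * B.ncard : ℕ) : R) = 2 * (q - 1) := by
      rw [hBc, hk, Nat.add_sub_cancel]; push_cast; ring
    by_cases h1 : e = 2 * n
    · subst h1
      rw [hpt.card_blockPairs_two_mul h2, hq1, if_pos rfl, if_neg hne]; ring
    · by_cases h3 : e = -(2 * n)
      · subst h3
        rw [hpt.card_blockPairs_neg, hpt.card_blockPairs_two_mul h2, hq1, if_pos rfl, if_neg h1]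
        ring
      · have h4 := hpt.card_blockPairs h2 htrans hpair hB h1 h3
        have e2 : q * (q + 1) / 2 = q * (k + 1) := by
          rw [show q + 1 = 2 * (k + 1) by omega, mul_left_comm, Nat.mul_div_cancel_left _ two_pos]
        rw [hcard, e2, hq, show 2 * (q * (q - 1) * (q + 1)) = q * (k + 1) * (8 * k) by
          rw [hk, Nat.add_sub_cancel]; ring] at h4
        have h5 := Nat.eq_of_mul_eq_mul_left (Nat.mul_pos (by omega) (Nat.succ_pos k)) h4
        rw [h5, if_neg h1, if_neg h3, hk]
        push_cast
        ring
  rw [← Finset.sum_product', ← Finset.sum_fiberwise _ (fun p => (p.1 * p.2).trace)]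
  have h1 : ∀ e : F, ∑ p ∈ (blockVectors n pt B ×ˢ blockVectors n pt B).filter
      (fun p => (p.1 * p.2).trace = e), f (p.1 * p.2).trace =
      ((blockPairs n pt B e).card : R) * f e := by
    intro e
    rw [Finset.sum_congr rfl (g := fun _ => f e), Finset.sum_const, nsmul_eq_mul]
    · rfl
    · intro p hp
      rw [(Finset.mem_filter.1 hp).2]
  rw [Finset.sum_congr rfl (fun e _ => h1 e)]
  simp only [hc, sub_mul, add_mul, ite_mul, zero_mul]
  rw [Finset.sum_sub_distrib, Finset.sum_add_distrib, ← Finset.mul_sum]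
  simp only [Finset.sum_ite_eq', Finset.mem_univ, if_true]
  ring

end Counting

/-! ### Endomorphisms of PSL(2, q) respecting the diagonal torus are semilinear -/

section Semilinear

variable {F : Type*} [Field F] {H : Type*} [Group H]
  {Φ : Matrix.SpecialLinearGroup (Fin 2) F →* H}

theorem slUpper_injective_map (hΦ : ∀ M, Φ M = 1 ↔ (M = 1 ∨ M = -1)) (h2 : (2 : F) ≠ 0) {a b : F}
    (h : Φ (slUpper a) = Φ (slUpper b)) : a = b := by
  rw [map_eq_map_iff hΦ] at h
  rcases h with h | h <;> rw [sl_ext_iff] at h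
  · simpa using h.2.1
  · exfalso
    have h1 := h.1
    rw [sl_neg_apply] at h1
    simp only [slUpper_apply_0_0] at h1
    exact h2 (by linear_combination h1)

/-- The condition `μ ^ 4 ≠ 1` expresses that `slDiag μ` has order greater than two modulo ±1. -/
theorem sq_ne_of_pow_four_ne_one {μ : Fˣ} (hμ : μ ^ 4 ≠ 1) :
    (μ : F) ^ 2 ≠ 1 ∧ (μ : F) ^ 2 ≠ -1 := by
  constructor <;> intro h <;> apply hμ <;> ext <;> push_cast <;>
    rw [show (μ : F) ^ 4 = (μ ^ 2 : F) ^ 2 by ring, h] <;> norm_num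

theorem exists_eq_slDiag {N : Matrix.SpecialLinearGroup (Fin 2) F} (h1 : N 0 1 = 0)
    (h3 : N 1 0 = 0) : ∃ t, N = slDiag t := by
  have hd := sl_det N
  rw [h1, zero_mul, sub_zero] at hd
  refine ⟨⟨N 0 0, N 1 1, hd, by rw [mul_comm, hd]⟩, ?_⟩
  rw [sl_ext_iff]
  simp [h1, h3]

theorem exists_eq_slAnti {N : Matrix.SpecialLinearGroup (Fin 2) F} (h1 : N 0 0 = 0)
    (h3 : N 1 1 = 0) : ∃ s, N = slAnti s := by
  have hd := sl_det N
  rw [h1, zero_mul, zero_sub] at hd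
  refine ⟨⟨N 0 1, -N 1 0, by linear_combination hd, by linear_combination hd⟩, ?_⟩
  rw [sl_ext_iff]
  simp [h1, h3]

/-- The centralizer in `PSL(2, F)` of a diagonal element of order greater than two is diagonal. -/
theorem exists_eq_slDiag_of_commute (hΦ : ∀ M, Φ M = 1 ↔ (M = 1 ∨ M = -1)) {μ : Fˣ}
    (hμ : μ ^ 4 ≠ 1) {N : Matrix.SpecialLinearGroup (Fin 2) F}
    (h : Φ N * Φ (slDiag μ) = Φ (slDiag μ) * Φ N) : ∃ t, N = slDiag t := by
  obtain ⟨e1, e2⟩ := sq_ne_of_pow_four_ne_one hμ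
  have hm : (μ : F) * ((μ⁻¹ : Fˣ) : F) = 1 := μ.mul_inv
  rw [← map_mul, ← map_mul, map_eq_map_iff hΦ, sl_ext_iff, sl_ext_iff] at h
  simp only [sl_neg_apply, sl_mul_apply, slDiag_apply_0_0, slDiag_apply_0_1, slDiag_apply_1_0,
    slDiag_apply_1_1] at h
  rcases h with ⟨-, k2, k3, -⟩ | ⟨-, k2, k3, -⟩
  · refine exists_eq_slDiag (mul_left_cancel₀ (sub_ne_zero.2 e1) ?_)
      (mul_left_cancel₀ (sub_ne_zero.2 e1) ?_)
    · linear_combination -μ * k2 + N 0 1 * hm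
    · linear_combination μ * k3 + N 1 0 * hm
  · refine exists_eq_slDiag (mul_left_cancel₀ (sub_ne_zero.2 e2) ?_)
      (mul_left_cancel₀ (sub_ne_zero.2 e2) ?_)
    · linear_combination μ * k2 - N 0 1 * hm
    · linear_combination μ * k3 - N 1 0 * hm

theorem exists_eq_slAnti_of_conj (hΦ : ∀ M, Φ M = 1 ↔ (M = 1 ∨ M = -1)) {μ : Fˣ}
    (hμ : μ ^ 4 ≠ 1) {N : Matrix.SpecialLinearGroup (Fin 2) F}
    (h : Φ N * Φ (slDiag μ) = Φ (slDiag μ⁻¹) * Φ N) : ∃ s, N = slAnti s := by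
  obtain ⟨e1, e2⟩ := sq_ne_of_pow_four_ne_one hμ
  have hm : (μ : F) * ((μ⁻¹ : Fˣ) : F) = 1 := μ.mul_inv
  rw [← map_mul, ← map_mul, map_eq_map_iff hΦ, sl_ext_iff, sl_ext_iff] at h
  simp only [sl_neg_apply, sl_mul_apply, slDiag_apply_0_0, slDiag_apply_0_1, slDiag_apply_1_0,
    slDiag_apply_1_1, inv_inv] at h
  rcases h with ⟨k1, -, -, k4⟩ | ⟨k1, -, -, k4⟩
  · refine exists_eq_slAnti (mul_left_cancel₀ (sub_ne_zero.2 e1) ?_)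
      (mul_left_cancel₀ (sub_ne_zero.2 e1) ?_)
    · linear_combination μ * k1 + N 0 0 * hm
    · linear_combination -μ * k4 + N 1 1 * hm
  · refine exists_eq_slAnti (mul_left_cancel₀ (sub_ne_zero.2 e2) ?_)
      (mul_left_cancel₀ (sub_ne_zero.2 e2) ?_)
    · linear_combination μ * k1 - N 0 0 * hm
    · linear_combination μ * k4 - N 1 1 * hm

theorem sl_eq_slUpper_or_neg {N : Matrix.SpecialLinearGroup (Fin 2) F} (h1 : N 1 0 = 0)
    (h3 : N 0 0 = N 1 1) : ∃ b, N = slUpper b ∨ N = -slUpper b := by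
  have hd := sl_det N
  rw [h1, mul_zero, sub_zero, ← h3, ← pow_two, sq_eq_one_iff] at hd
  rcases hd with hd | hd
  · refine ⟨N 0 1, Or.inl ?_⟩
    rw [sl_ext_iff]
    simp [h1, ← h3, hd]
  · refine ⟨-N 0 1, Or.inr ?_⟩
    rw [sl_ext_iff]
    simp only [sl_neg_apply]
    simp [h1, ← h3, hd]

theorem exists_map_eq_slUpper (hΦ : ∀ M, Φ M = 1 ↔ (M = 1 ∨ M = -1))
    {N : Matrix.SpecialLinearGroup (Fin 2) F} (h1 : N 1 0 = 0) (h3 : N 0 0 = N 1 1) :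
    ∃ b, Φ N = Φ (slUpper b) := by
  obtain ⟨b, h | h⟩ := sl_eq_slUpper_or_neg h1 h3
  · exact ⟨b, by rw [h]⟩
  · exact ⟨b, by rw [h, map_neg_of_map_eq_one hΦ]⟩

/-- The centralizer in `PSL(2, F)` of a nontrivial upper unitriangular element is upper
unitriangular. -/
theorem exists_map_eq_slUpper_of_commute (hΦ : ∀ M, Φ M = 1 ↔ (M = 1 ∨ M = -1))
    (h2 : (2 : F) ≠ 0) {β : F} (hβ : β ≠ 0) {N : Matrix.SpecialLinearGroup (Fin 2) F}
    (h : Φ N * Φ (slUpper β) = Φ (slUpper β) * Φ N) : ∃ b, Φ N = Φ (slUpper b) := by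
  rw [← map_mul, ← map_mul, map_eq_map_iff hΦ, sl_ext_iff, sl_ext_iff] at h
  simp only [sl_neg_apply, sl_mul_apply, slUpper_apply_0_0, slUpper_apply_0_1, slUpper_apply_1_0,
    slUpper_apply_1_1] at h
  have hd := sl_det N
  rcases h with ⟨k1, k2, k3, k4⟩ | ⟨k1, k2, k3, k4⟩
  · refine exists_map_eq_slUpper hΦ (mul_left_cancel₀ hβ ?_) (mul_left_cancel₀ hβ ?_)
    · linear_combination -k1
    · linear_combination k2
  · exfalso
    have h10 : N 1 0 = 0 := mul_left_cancel₀ h2 (by linear_combination k3)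
    have h00 : N 0 0 = 0 := mul_left_cancel₀ h2 (by linear_combination k1 - β * h10)
    rw [h10, h00] at hd
    simp at hd

/-- An element of `SL(2, F)` with double eigenvalue that commutes in `PSL(2, F)` with its
conjugate by a diagonal element of order greater than two is triangular. -/
theorem triangular_of_commute_conj (hΦ : ∀ M, Φ M = 1 ↔ (M = 1 ∨ M = -1))
    (h2 : (2 : F) ≠ 0) {μ : Fˣ} (hμ : μ ^ 4 ≠ 1) {N : Matrix.SpecialLinearGroup (Fin 2) F}
    (hN : slDisc N = 0)
    (h : Φ N * Φ (slDiag μ * N * (slDiag μ)⁻¹) = Φ (slDiag μ * N * (slDiag μ)⁻¹) * Φ N) :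
    N 0 0 = N 1 1 ∧ (N 0 1 = 0 ∨ N 1 0 = 0) := by
  obtain ⟨e1, e2⟩ := sq_ne_of_pow_four_ne_one hμ
  have hm : (μ : F) * ((μ⁻¹ : Fˣ) : F) = 1 := μ.mul_inv
  set m : F := ((μ⁻¹ : Fˣ) : F) with hm_def
  have hμ0 : (μ : F) ≠ 0 := μ.ne_zero
  obtain ⟨i1, i2, i3, i4⟩ := sl_inv_apply (slDiag μ)
  rw [← map_mul, ← map_mul, map_eq_map_iff hΦ, sl_ext_iff, sl_ext_iff] at h
  simp only [sl_neg_apply, sl_mul_apply, slDiag_apply_0_0, slDiag_apply_0_1, slDiag_apply_1_0,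
    slDiag_apply_1_1, i1, i2, i3, i4, ← hm_def] at h
  have hd := sl_det N
  have ht : (N 0 0 + N 1 1) ^ 2 = 4 := sub_eq_zero.1 hN
  have ht0 : N 0 0 + N 1 1 ≠ 0 := by
    intro h0
    rw [h0] at ht
    exact mul_ne_zero h2 h2 (by linear_combination -ht)
  have hsq : (N 0 0 - N 1 1) ^ 2 = -4 * (N 0 1 * N 1 0) := by linear_combination ht - 4 * hd
  have hμ1 : (μ : F) ^ 2 - 1 ≠ 0 := sub_ne_zero.2 e1
  have hμ2 : (μ : F) ^ 2 + 1 ≠ 0 := fun h0 => e2 (by linear_combination h0)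
  have hfin : N 0 1 * N 1 0 = 0 → N 0 0 = N 1 1 ∧ (N 0 1 = 0 ∨ N 1 0 = 0) := by
    intro h0
    rw [h0, mul_zero] at hsq
    exact ⟨sub_eq_zero.1 (pow_eq_zero_iff two_ne_zero |>.1 hsq), mul_eq_zero.1 h0⟩
  rcases h with ⟨k1, -, -, -⟩ | ⟨-, k2, -, -⟩
  · apply hfin
    refine mul_left_cancel₀ (mul_ne_zero hμ1 hμ2) ?_
    have k1' : N 0 1 * N 1 0 * (m ^ 2 - μ ^ 2) = 0 := by linear_combination k1
    linear_combination -μ ^ 2 * k1' + N 0 1 * N 1 0 * (μ * m + 1) * hm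
  · have hb : N 0 1 = 0 := by
      refine mul_left_cancel₀ (mul_ne_zero ht0 hμ2) ?_
      linear_combination k2 - (N 0 0 + N 1 1) * N 0 1 * hm
    exact hfin (by rw [hb, zero_mul])

end Semilinear

section Semilinear

variable {F : Type*} [Field F] {H : Type*} [Group H]
  {Φ ψ : Matrix.SpecialLinearGroup (Fin 2) F →* H}

/-- This relation lets the image of a unipotent element determine, up to sign, the image of the Weyl
element. -/
theorem slAnti_eq_product :
    slUpper (1 : F) * (slAnti 1 * slUpper 1 * (slAnti 1)⁻¹) * slUpper 1 = slAnti 1 := by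
  obtain ⟨i1, i2, i3, i4⟩ := sl_inv_apply (slAnti (1 : Fˣ))
  rw [sl_ext_iff]
  simp only [sl_mul_apply, i1, i2, i3, i4]
  simp

theorem slAnti_conj_slDiag (s t : Fˣ) :
    slAnti s * slDiag t * (slAnti s)⁻¹ = slDiag t⁻¹ := by
  rw [mul_inv_eq_iff_eq_mul, sl_ext_iff]
  simp only [sl_mul_apply]
  simp [mul_comm]

theorem sl_eq_bruhat (M : Matrix.SpecialLinearGroup (Fin 2) F) (c : Fˣ) (hc : (c : F) = -M 1 0) :
    M = slUpper (M 0 0 / M 1 0) * (slAnti 1 * slDiag c) * slUpper (M 1 1 / M 1 0) := by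
  have hd := sl_det M
  have h0 : M 1 0 ≠ 0 := by
    intro h; rw [h, neg_zero] at hc; exact c.ne_zero hc
  rw [sl_ext_iff]
  simp only [sl_mul_apply]
  simp only [slUpper_apply_0_0, slUpper_apply_0_1, slUpper_apply_1_0, slUpper_apply_1_1,
    slAnti_apply_0_0, slAnti_apply_0_1, slAnti_apply_1_0, slAnti_apply_1_1, slDiag_apply_0_0,
    slDiag_apply_0_1, slDiag_apply_1_0, slDiag_apply_1_1, Units.val_inv_eq_inv_val, hc,
    Units.val_one, inv_one]
  refine ⟨?_, ?_, ?_, ?_⟩ <;> field_simp <;> first | ring1 | linear_combination -(M 1 0) * hd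

/-- An injective additive self-map of a field that fixes one and is multiplicative with respect to
squares is a ring homomorphism. -/
theorem exists_ringHom_of_sq_mul (h2 : (2 : F) ≠ 0) (σ : F → F) (h1 : σ 1 = 1)
    (hadd : ∀ a b, σ (a + b) = σ a + σ b) (hsq : ∀ t b, σ (t ^ 2 * b) = σ (t ^ 2) * σ b) :
    ∃ τ : F →+* F, ∀ a, τ a = σ a := by
  have h0 : σ 0 = 0 := by simpa using hadd 0 0
  have hneg : ∀ a, σ (-a) = -σ a := fun a => by
    have := hadd (-a) a
    rw [neg_add_cancel, h0] at this
    exact eq_neg_of_add_eq_zero_left this.symm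
  have hmul : ∀ a b, σ (a * b) = σ a * σ b := by
    intro a b
    -- Every element is a difference of two squares, so multiplicativity on squares extends by
    -- additivity.
    have ha : a = ((a + 1) / 2) ^ 2 + -((a - 1) / 2) ^ 2 := by field_simp; ring
    have hab : a * b = ((a + 1) / 2) ^ 2 * b + -(((a - 1) / 2) ^ 2 * b) := by
      conv_lhs => rw [ha]
      ring
    rw [hab, hadd, hneg, hsq, hsq]
    conv_rhs => rw [ha, hadd, hneg]
    ring
  exact ⟨{ toFun := σ, map_one' := h1, map_mul' := hmul, map_zero' := h0, map_add' := hadd },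
    fun _ => rfl⟩

/-- Centralizers force ψ to preserve the unipotent group and the torus. On the unipotent group ψ is
b ↦ βσ(b); compatibility with torus conjugation makes σ a ring homomorphism, and ψ sends the Weyl
element to its β-scaled version. The Bruhat decomposition then gives ψ on the big cell M₁₀ ≠ 0.
Scaling by β amounts to a diagonal change of basis, so it does not affect diagonal entries. -/
theorem exists_ringHom_of_map_slUpper (hΦ : ∀ M, Φ M = 1 ↔ (M = 1 ∨ M = -1))
    (h2 : (2 : F) ≠ 0) (hr : ∀ M, ∃ M', ψ M = Φ M') {l μ : Fˣ} (hμ : μ ^ 4 ≠ 1)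
    (hl : ψ (slDiag l) = Φ (slDiag μ)) {β : F} (hβ : β ≠ 0)
    (hβu : ψ (slUpper 1) = Φ (slUpper β)) :
    ∃ σ : F →+* F, ∀ M, M 1 0 ≠ 0 → ∃ M', ψ M = Φ M' ∧ M' 0 0 = σ (M 0 0) ∧
      M' 1 1 = σ (M 1 1) := by
  have hupper : ∀ b : F, ∃ b', ψ (slUpper b) = Φ (slUpper b') := by
    intro b
    obtain ⟨N, hN⟩ := hr (slUpper b)
    rw [hN]
    apply exists_map_eq_slUpper_of_commute hΦ h2 hβ
    rw [← hN, ← hβu, ← map_mul, ← map_mul, ← slUpper_add, ← slUpper_add, add_comm]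
  choose f hf using hupper
  have hadd : ∀ a b, f (a + b) = f a + f b := by
    intro a b
    apply slUpper_injective_map hΦ h2
    rw [← hf, slUpper_add, slUpper_add, map_mul, map_mul, hf, hf]
  have hf1 : f 1 = β := slUpper_injective_map hΦ h2 (by rw [← hf, hβu])
  have hdiag : ∀ t : Fˣ, ∃ t', ψ (slDiag t) = Φ (slDiag t') := by
    intro t
    obtain ⟨N, hN⟩ := hr (slDiag t)
    obtain ⟨t', rfl⟩ := exists_eq_slDiag_of_commute hΦ hμ (N := N) (by
      rw [← hN, ← hl, ← map_mul, ← map_mul, ← slDiag_mul, ← slDiag_mul, mul_comm])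
    exact ⟨t', hN⟩
  choose d hd using hdiag
  have hfd : ∀ (t : Fˣ) b, f (t ^ 2 * b) = d t ^ 2 * f b := by
    intro t b
    apply slUpper_injective_map hΦ h2
    rw [← hf, ← slDiag_conj_slUpper, ← slDiag_conj_slUpper, map_mul, map_mul, map_mul, map_mul,
      map_inv, map_inv, hf, hd]
  obtain ⟨A, hA⟩ := hr (slAnti 1)
  obtain ⟨s, rfl⟩ := exists_eq_slAnti_of_conj hΦ hμ (N := A) (by
    have h3 := congrArg ψ (slAnti_conj_slDiag (1 : Fˣ) l)
    have hinv : ∀ t : Fˣ, slDiag t⁻¹ = (slDiag t)⁻¹ := fun t => map_inv slDiagHom t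
    rw [map_mul, map_mul, map_inv, hA, hl, hinv, map_inv, hl, mul_inv_eq_iff_eq_mul] at h3
    rw [h3, hinv, map_inv])
  have hs : (s : F) = β ∨ (s : F) = -β := by
    have h3 := congrArg ψ (slAnti_eq_product (F := F))
    simp only [map_mul, map_inv, hA, hβu] at h3
    simp only [← map_mul, ← map_inv] at h3
    rw [map_eq_map_iff hΦ, sl_ext_iff, sl_ext_iff] at h3
    obtain ⟨i1, i2, i3, i4⟩ := sl_inv_apply (slAnti s)
    have h4 : 1 - β ^ 2 * ((s⁻¹ : Fˣ) : F) ^ 2 = 0 := by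
      simp only [sl_neg_apply, sl_mul_apply, i1, i2, i3, i4] at h3
      simp only [slUpper_apply_0_0, slUpper_apply_0_1, slUpper_apply_1_0, slUpper_apply_1_1,
        slAnti_apply_0_0, slAnti_apply_0_1, slAnti_apply_1_0, slAnti_apply_1_1] at h3
      have hm : (s : F) * ((s⁻¹ : Fˣ) : F) = 1 := s.mul_inv
      rcases h3 with ⟨k, -⟩ | ⟨k, -⟩ <;> linear_combination k - hm
    have h5 : (s : F) ^ 2 = β ^ 2 := by
      have hm : (s : F) * ((s⁻¹ : Fˣ) : F) = 1 := s.mul_inv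
      linear_combination s ^ 2 * h4 + β ^ 2 * (s * ((s⁻¹ : Fˣ) : F) + 1) * hm
    exact sq_eq_sq_iff_eq_or_eq_neg.1 h5
  have hw : ψ (slAnti 1) = Φ (slAnti (Units.mk0 β hβ)) := by
    rw [hA, map_eq_map_iff hΦ, sl_ext_iff, sl_ext_iff]
    rcases hs with h | h
    · left; simp [h]
    · right
      simp only [sl_neg_apply]
      simp [h, inv_neg]
  obtain ⟨σ, hσ⟩ := exists_ringHom_of_sq_mul h2 (fun b => f b / β)
    (by simp only [hf1]; exact div_self hβ) (fun a b => by simp only [hadd, add_div]) (by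
      intro t b
      by_cases ht : t = 0
      · have hf0 : f 0 = 0 := by simpa using hadd 0 0
        simp [ht, hf0]
      · have h3 := hfd (Units.mk0 t ht) b
        have h4 := hfd (Units.mk0 t ht) 1
        rw [hf1, mul_one] at h4
        simp only [Units.val_mk0] at h3 h4
        simp only [h3, h4]
        field_simp)
  have hfσ : ∀ b, f b = β * σ b := fun b => by rw [hσ]; field_simp
  have hdσ : ∀ t : Fˣ, ψ (slDiag t) = Φ (slDiag (Units.map σ.toMonoidHom t)) := by
    intro t
    have h3 := hfd t 1
    rw [hf1, mul_one, hfσ, map_pow] at h3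
    have h4 : (d t : F) ^ 2 = (σ t) ^ 2 := mul_left_cancel₀ hβ (by linear_combination -h3)
    rw [hd, map_eq_map_iff hΦ, sl_ext_iff, sl_ext_iff]
    simp only [sl_neg_apply]
    rcases sq_eq_sq_iff_eq_or_eq_neg.1 h4 with h | h
    · left; simp [h]
    · right; simp [h, inv_neg]
  refine ⟨σ, fun M hM => ?_⟩
  have hσM : σ (M 1 0) ≠ 0 := (map_ne_zero σ).2 hM
  refine ⟨slUpper (f (M 0 0 / M 1 0)) * (slAnti (Units.mk0 β hβ) *
    slDiag (Units.map σ.toMonoidHom (Units.mk0 (-M 1 0) (neg_ne_zero.2 hM)))) *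
    slUpper (f (M 1 1 / M 1 0)), ?_, ?_, ?_⟩
  · conv_lhs => rw [sl_eq_bruhat M (Units.mk0 (-M 1 0) (neg_ne_zero.2 hM)) rfl]
    simp only [map_mul, hf, hw, hdσ]
  · simp only [sl_mul_apply]
    simp only [slUpper_apply_0_0, slUpper_apply_0_1, slUpper_apply_1_0,
      slAnti_apply_0_0, slAnti_apply_0_1, slAnti_apply_1_0, slAnti_apply_1_1, slDiag_apply_0_0,
      slDiag_apply_0_1, slDiag_apply_1_0, slDiag_apply_1_1, hfσ]
    simp
    field_simp
  · simp only [sl_mul_apply]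
    simp only [slUpper_apply_0_1, slUpper_apply_1_0, slUpper_apply_1_1,
      slAnti_apply_0_0, slAnti_apply_0_1, slAnti_apply_1_0, slAnti_apply_1_1, slDiag_apply_0_0,
      slDiag_apply_0_1, slDiag_apply_1_0, slDiag_apply_1_1, hfσ]
    simp
    field_simp

end Semilinear

section Semilinear

variable {F : Type*} [Field F] {H : Type*} [Group H]
  {Φ ψ : Matrix.SpecialLinearGroup (Fin 2) F →* H}

theorem slUpper_pow (m : ℕ) (b : F) : slUpper b ^ m = slUpper (m * b) := by
  induction m with
  | zero => rw [sl_ext_iff]; simp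
  | succ m ih => rw [pow_succ, ih, ← slUpper_add]; push_cast; congr 1; ring

theorem slAnti_one_conj_apply (N : Matrix.SpecialLinearGroup (Fin 2) F) :
    (slAnti (1 : Fˣ) * N * (slAnti (1 : Fˣ))⁻¹ : Matrix.SpecialLinearGroup (Fin 2) F) 0 0 = N 1 1 ∧
    (slAnti (1 : Fˣ) * N * (slAnti (1 : Fˣ))⁻¹ : Matrix.SpecialLinearGroup (Fin 2) F) 1 1 = N 0 0 ∧
    (slAnti (1 : Fˣ) * N * (slAnti (1 : Fˣ))⁻¹ : Matrix.SpecialLinearGroup (Fin 2) F) 1 0 =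
      -N 0 1 := by
  obtain ⟨i1, i2, i3, i4⟩ := sl_inv_apply (slAnti (1 : Fˣ))
  simp only [sl_mul_apply, i1, i2, i3, i4]
  simp

variable [Finite F]

theorem natCast_natCard_eq_zero {q : ℕ} (hq : Nat.card F = q) : (q : F) = 0 := by
  have := Fintype.ofFinite F
  rw [← hq, Nat.card_eq_fintype_card]
  exact FiniteField.cast_card_eq_zero F

/-- A homomorphism of `PSL(2, F)` into itself that maps some diagonal element to a diagonal element
of order greater than two is, up to a diagonal or antidiagonal change of basis, given by a ring
endomorphism of `F`. -/
theorem exists_ringHom_of_map_slDiag (hΦ : ∀ M, Φ M = 1 ↔ (M = 1 ∨ M = -1))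
    (hψ : ∀ M, ψ M = 1 ↔ (M = 1 ∨ M = -1)) (h2 : (2 : F) ≠ 0) {q : ℕ} (hq : Nat.card F = q)
    (hodd : Odd q) (hr : ∀ M, ∃ M', ψ M = Φ M') {l μ : Fˣ} (hμ : μ ^ 4 ≠ 1)
    (hl : ψ (slDiag l) = Φ (slDiag μ)) :
    ∃ σ : F →+* F, ∀ M, M 1 0 ≠ 0 → ∃ M', ψ M = Φ M' ∧
      (M' 0 0 - M' 1 1) ^ 2 = σ ((M 0 0 - M 1 1) ^ 2) ∧ M' 0 0 + M' 1 1 = σ (M 0 0 + M 1 1) := by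
  obtain ⟨k, hk⟩ := hodd
  have hne1 : ψ (slUpper 1) ≠ 1 := by
    intro h
    have h3 := slUpper_injective_map (a := (1 : F)) (b := 0) hψ h2 (by
      rw [h, eq_comm, hψ]; left; rw [sl_ext_iff]; simp)
    exact one_ne_zero h3
  obtain ⟨N, hN⟩ := hr (slUpper 1)
  have hNq : Φ N ^ q = 1 := by
    rw [← hN, ← map_pow, slUpper_pow, natCast_natCard_eq_zero hq, hψ]
    left; rw [sl_ext_iff]; simp
  -- With nonzero discriminant, N^q would be N or N⁻¹, so Φ(N)^q = 1 would make Φ(N) trivial.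
  have hdisc : slDisc N = 0 := by
    by_contra h0
    apply hne1
    rw [hN]
    by_cases hs : IsSquare (slDisc N)
    · rwa [← map_pow, sl_pow_card_of_isSquare hq hk h2 h0 hs] at hNq
    · rwa [← map_pow, sl_pow_card_of_not_isSquare hq hk h2 hs, map_inv, inv_eq_one] at hNq
  -- Conjugating by the torus takes `slUpper 1` to another upper unitriangular element, which
  -- commutes with it; hence N commutes in the image with its own torus conjugate.
  obtain ⟨hN1, hN2⟩ := triangular_of_commute_conj hΦ h2 hμ hdisc (by
    have h3 : Φ (slDiag μ * N * (slDiag μ)⁻¹) = ψ (slUpper (l ^ 2 * 1)) := by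
      rw [← slDiag_conj_slUpper, map_mul, map_mul, map_mul, map_mul, map_inv, map_inv, hN, hl]
    rw [h3, ← hN, ← map_mul, ← map_mul, ← slUpper_add, ← slUpper_add, add_comm])
  rcases hN2 with h01 | h10
  -- The lower triangular case reduces to the upper one by conjugating with the Weyl element. This
  -- swaps the diagonal entries, which is why the conclusion speaks only of their sum and the square
  -- of their difference.
  · set ψ' : Matrix.SpecialLinearGroup (Fin 2) F →* H :=
      (MulAut.conj (Φ (slAnti 1))).toMonoidHom.comp ψ with hψ'
    have happ : ∀ M, ψ' M = Φ (slAnti 1) * ψ M * (Φ (slAnti 1))⁻¹ := fun _ => rfl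
    have happ' : ∀ M M', ψ M = Φ M' → ψ' M = Φ (slAnti 1 * M' * (slAnti 1)⁻¹) := by
      intro M M' h
      rw [happ, h, map_mul, map_mul, map_inv]
    obtain ⟨w1, w2, w3⟩ := slAnti_one_conj_apply N
    obtain ⟨β, hβ⟩ := exists_map_eq_slUpper hΦ (N := slAnti 1 * N * (slAnti 1)⁻¹)
      (by rw [w3, h01, neg_zero]) (by rw [w1, w2, hN1])
    have hβ' : ψ' (slUpper 1) = Φ (slUpper β) := by rw [happ' _ _ hN, hβ]
    have hβ0 : β ≠ 0 := by
      rintro rfl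
      have h3 : Φ (slUpper (0 : F)) = 1 := by rw [hΦ]; left; rw [sl_ext_iff]; simp
      rw [h3, happ, conj_eq_one_iff] at hβ'
      exact hne1 hβ'
    have hl' : ψ' (slDiag l) = Φ (slDiag μ⁻¹) := by rw [happ' _ _ hl, slAnti_conj_slDiag]
    obtain ⟨σ, hσ⟩ := exists_ringHom_of_map_slUpper hΦ h2
      (fun M => by obtain ⟨M', h⟩ := hr M; exact ⟨_, happ' _ _ h⟩)
      (μ := μ⁻¹) (by rwa [inv_pow, ne_eq, inv_eq_one]) hl' hβ0 hβ'
    refine ⟨σ, fun M hM => ?_⟩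
    obtain ⟨M₂, hM₂⟩ := hr M
    obtain ⟨M'', hM'', e1, e2⟩ := hσ M hM
    rw [happ' _ _ hM₂, map_eq_map_iff hΦ] at hM''
    obtain ⟨w1, w2, w3⟩ := slAnti_one_conj_apply M₂
    rcases hM'' with h | h <;> rw [sl_ext_iff] at h
    · rw [w1, w2] at h
      refine ⟨M₂, hM₂, ?_, ?_⟩
      · rw [h.1, h.2.2.2, e1, e2, map_pow, map_sub]; ring
      · rw [h.1, h.2.2.2, e1, e2, map_add]; ring
    · simp only [sl_neg_apply] at h
      rw [w1, w2] at h
      refine ⟨-M₂, by rw [map_neg_of_map_eq_one hΦ, hM₂], ?_, ?_⟩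
      · rw [sl_neg_apply, sl_neg_apply, h.1, h.2.2.2, e1, e2, map_pow, map_sub]; ring
      · rw [sl_neg_apply, sl_neg_apply, h.1, h.2.2.2, e1, e2, map_add]; ring
  · obtain ⟨β, hβ⟩ := exists_map_eq_slUpper hΦ h10 hN1
    rw [← hN] at hβ
    have hβ0 : β ≠ 0 := by
      rintro rfl
      apply hne1
      rw [hβ, hΦ]; left; rw [sl_ext_iff]; simp
    obtain ⟨σ, hσ⟩ := exists_ringHom_of_map_slUpper hΦ h2 hr hμ hl hβ0 hβ
    refine ⟨σ, fun M hM => ?_⟩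
    obtain ⟨M', hM', e1, e2⟩ := hσ M hM
    exact ⟨M', hM', by rw [e1, e2, map_pow, map_sub], by rw [e1, e2, map_add]⟩

end Semilinear

/-! ### Semilinear action on the diagonal coordinates of points -/

section Points

variable {F : Type*} [Field F] {P : Type*} {n : F}

/-- If an element of `SL(2, F)` with nonzero trace fixes an internal point, then the coordinates of
the point are determined by the element. -/
theorem IsInner.sq_mul_of_slConj (hn : ¬ IsSquare n) {Y : Matrix (Fin 2) (Fin 2) F}
    (hY : IsInner n Y) {M : Matrix.SpecialLinearGroup (Fin 2) F} (ht : M 0 0 + M 1 1 ≠ 0)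
    (h : Y = _root_.slConj M Y ∨ Y = -_root_.slConj M Y) :
    (M 0 0 - M 1 1) ^ 2 * n = Y 0 0 ^ 2 * ((M 0 0 + M 1 1) ^ 2 - 4) := by
  have hd := sl_det M
  have hb := hY.upper_right_ne_zero hn
  obtain ⟨hY1, hY2⟩ := hY
  have hmul : _root_.slConj M Y * M.1 = M.1 * Y := by
    rw [_root_.slConj, mul_assoc, coe_inv_mul_coe, mul_one]
  -- M commutes or anticommutes with Y. The second is impossible for nonzero trace; the first makes
  -- the traceless part of M proportional to Y.
  have key : Y * M.1 = M.1 * Y ∨ Y * M.1 = -(M.1 * Y) := by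
    rcases h with h | h
    · left; conv_lhs => rw [h]
      exact hmul
    · right; conv_lhs => rw [h]
      rw [neg_mul, hmul]
  rcases key with h | h
  · have k1 := congrFun (congrFun h 0) 1
    have k2 := congrFun (congrFun h 1) 0
    simp only [Matrix.mul_apply, Fin.sum_univ_two, hY1] at k1 k2
    have k1' : (M 0 0 - M 1 1) * Y 0 1 = 2 * Y 0 0 * M 0 1 := by linear_combination -k1
    have k2' : (M 0 0 - M 1 1) * Y 1 0 = 2 * Y 0 0 * M 1 0 := by linear_combination k2
    linear_combination -(M 0 0 - M 1 1) ^ 2 * hY2 + (M 0 0 - M 1 1) * Y 1 0 * k1' +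
      2 * Y 0 0 * M 0 1 * k2' - 4 * Y 0 0 ^ 2 * hd
  · exfalso
    have k1 := congrFun (congrFun h 0) 1
    simp only [Matrix.neg_apply, Matrix.mul_apply, Fin.sum_univ_two, hY1] at k1
    exact mul_ne_zero ht hb (by linear_combination k1)

variable [Finite F]

/-- A permutation normalizing the action of `PSL(2, F)` and the torus of diagonal elements acts on
the squares of the diagonal coordinates of the points by a ring endomorphism. -/
theorem IsPointModel.exists_ringHom {Φ : Matrix.SpecialLinearGroup (Fin 2) F →* Equiv.Perm P}
    {pt : Matrix (Fin 2) (Fin 2) F → P} (hpt : IsPointModel Φ n pt)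
    (hΦ : ∀ M, Φ M = 1 ↔ (M = 1 ∨ M = -1)) (h2 : (2 : F) ≠ 0) {q : ℕ} (hq : Nat.card F = q)
    (hodd : Odd q) {g : Equiv.Perm P} (hg : ∀ M, ∃ M', g * Φ M * g⁻¹ = Φ M')
    {l μ : Fˣ} (hμ : μ ^ 4 ≠ 1) (hl : g * Φ (slDiag l) * g⁻¹ = Φ (slDiag μ)) :
    ∃ σ : F →+* F, ∀ X Y, IsInner n X → IsInner n Y → pt Y = g (pt X) →
      Y 0 0 ^ 2 * σ n = n * σ (X 0 0 ^ 2) := by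
  have hn := hpt.not_isSquare
  have hn0 : n ≠ 0 := fun h => hn (h ▸ IsSquare.zero)
  obtain ⟨σ, hσ⟩ := exists_ringHom_of_map_slDiag (Φ := Φ)
    (ψ := (MulAut.conj g).toMonoidHom.comp Φ) hΦ (fun M => by
      rw [← hΦ M]; exact conj_eq_one_iff) h2 hq hodd hg hμ hl
  refine ⟨σ, fun X Y hX hY hXY => ?_⟩
  -- The coordinates of a point are read off a rotation fixing it. Conjugation by g turns this
  -- rotation into one fixing the image point, and σ controls its diagonal entries.
  obtain ⟨M, τ, β, hτ, hβ, hM⟩ := hpt.rotation X hX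
  have hM00 : M 0 0 = τ + β * X 0 0 := by
    have := congrFun (congrFun hM 0) 0
    simpa using this
  have hM11 : M 1 1 = τ - β * X 0 0 := by
    have := congrFun (congrFun hM 1) 1
    simpa [hX.1, ← sub_eq_add_neg] using this
  have hM10 : M 1 0 = β * X 1 0 := by
    have := congrFun (congrFun hM 1) 0
    simpa using this
  have hM01 : M 0 1 = β * X 0 1 := by
    have := congrFun (congrFun hM 0) 1
    simpa using this
  obtain ⟨M', hM', e1, e2⟩ := hσ M (by
    rw [hM10]; exact mul_ne_zero hβ (hX.lower_left_ne_zero hn))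
  have hfix : Φ M (pt X) = pt X := by
    rw [hpt.equivariant M X hX, eq_comm, hpt.eq_iff X _ hX (hX.slConj M)]
    left
    have hc : M.1 * X = X * M.1 := by rw [hM]; simp [mul_add, add_mul]
    rw [slConj, hc, mul_assoc, coe_mul_coe_inv, mul_one]
  have hfix' : Φ M' (pt Y) = pt Y := by
    have h3 : g * Φ M * g⁻¹ = Φ M' := hM'
    rw [← h3, hXY, ← Equiv.Perm.mul_apply, inv_mul_cancel_right, Equiv.Perm.mul_apply, hfix]
  rw [hpt.equivariant M' Y hY, hpt.eq_iff _ Y (hY.slConj M') hY] at hfix'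
  have htr : M 0 0 + M 1 1 = 2 * τ := by rw [hM00, hM11]; ring
  have ht' : M' 0 0 + M' 1 1 ≠ 0 := by
    rw [e2, htr]
    exact (map_ne_zero σ).2 (mul_ne_zero h2 hτ)
  have k1 := hY.sq_mul_of_slConj hn ht' hfix'
  have hd := sl_det M
  rw [hM00, hM11, hM01, hM10] at hd
  have hZ : (M 0 0 + M 1 1) ^ 2 - 4 = 4 * β ^ 2 * n := by
    rw [htr, ← hX.2]; linear_combination 4 * hd
  have hsub : (M 0 0 - M 1 1) ^ 2 = 4 * β ^ 2 * X 0 0 ^ 2 := by rw [hM00, hM11]; ring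
  have hZ' : (M' 0 0 + M' 1 1) ^ 2 - 4 = σ (4 * β ^ 2) * σ n := by
    rw [e2, ← map_mul, ← hZ, map_sub, map_pow, map_ofNat]
  rw [hZ', e1, hsub, map_mul] at k1
  have h4 : (4 : F) ≠ 0 := by rw [show (4 : F) = 2 * 2 by norm_num]; exact mul_ne_zero h2 h2
  have hσ0 : σ (4 * β ^ 2) ≠ 0 := (map_ne_zero σ).2 (mul_ne_zero h4 (pow_ne_zero 2 hβ))
  apply mul_left_cancel₀ hσ0
  linear_combination -k1

end Points

/-! ### Making the rotations of a block stabilizer diagonal -/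

section Torus

variable {F : Type*} [Field F]

theorem exists_sl {a b c d : F} (h : a * d - b * c = 1) :
    ∃ A : Matrix.SpecialLinearGroup (Fin 2) F, A 0 0 = a ∧ A 0 1 = b ∧ A 1 0 = c ∧ A 1 1 = d :=
  ⟨⟨!![a, b; c, d], by rw [det_fin_two_of, h]⟩, rfl, rfl, rfl, rfl⟩

/-- An element of `SL(2, F)` with nonzero square discriminant is diagonalizable. -/
theorem exists_conj_slDiag (h2 : (2 : F) ≠ 0) {M : Matrix.SpecialLinearGroup (Fin 2) F}
    (hs : IsSquare (slDisc M)) (h0 : slDisc M ≠ 0) : ∃ h l, h⁻¹ * M * h = slDiag l := by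
  have hd := sl_det M
  obtain ⟨δ, hδ⟩ := hs
  have hδ0 : δ ≠ 0 := by rintro rfl; exact h0 (by rw [hδ, mul_zero])
  rw [slDisc] at hδ
  suffices ∃ h : Matrix.SpecialLinearGroup (Fin 2) F, ∃ l : Fˣ, M * h = h * slDiag l by
    obtain ⟨h, l, e⟩ := this
    exact ⟨h, l, by rw [mul_assoc, e, inv_mul_cancel_left]⟩
  by_cases hc : M 1 0 = 0
  · rw [hc, mul_zero, sub_zero] at hd
    have hne : M 1 1 - M 0 0 ≠ 0 := by
      intro h
      apply hδ0
      have : δ * δ = 0 := by rw [← hδ]; linear_combination (M 1 1 - M 0 0) * h + 4 * hd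
      exact mul_self_eq_zero.1 this
    refine ⟨slUpper (M 0 1 / (M 1 1 - M 0 0)), ⟨M 0 0, M 1 1, hd, by rw [mul_comm, hd]⟩, ?_⟩
    rw [sl_ext_iff]
    simp only [sl_mul_apply]
    simp [hc]
    field_simp
    ring
  · set x : F := (M 0 0 + M 1 1 + δ) / 2 with hx
    set y : F := (M 0 0 + M 1 1 - δ) / 2 with hy
    have hxy : x * y = 1 := by
      rw [hx, hy, div_mul_div_comm, div_eq_one_iff_eq (mul_ne_zero h2 h2)]
      linear_combination hδ
    have hsum : x + y = M 0 0 + M 1 1 := by rw [hx, hy]; field_simp; ring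
    have hdiff : x - y = δ := by rw [hx, hy]; field_simp; ring
    -- The columns are eigenvectors for the eigenvalues x and y, the second scaled by 1/(M₁₀δ) to
    -- make the determinant 1.
    obtain ⟨h, e1, e2, e3, e4⟩ := exists_sl (a := x - M 1 1) (b := (y - M 1 1) / (M 1 0 * δ))
      (c := M 1 0) (d := δ⁻¹) (by field_simp; linear_combination hdiff)
    refine ⟨h, ⟨x, y, hxy, by rw [mul_comm, hxy]⟩, ?_⟩
    rw [sl_ext_iff]
    simp only [sl_mul_apply, slDiag_apply_0_0, slDiag_apply_0_1, slDiag_apply_1_0,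
      slDiag_apply_1_1, Units.inv_mk, e1, e2, e3, e4]
    refine ⟨?_, ?_, ?_, ?_⟩
    · linear_combination hxy - hd - x * hsum
    · field_simp
      linear_combination hxy - hd - y * hsum
    · ring
    · field_simp
      ring

theorem slDiag_pow (t : Fˣ) (m : ℕ) : slDiag (t ^ m) = slDiag t ^ m := map_pow slDiagHom t m

theorem slDiag_zpow (t : Fˣ) (m : ℤ) : slDiag (t ^ m) = slDiag t ^ m := map_zpow slDiagHom t m

theorem slDiag_neg_one : slDiag (-1 : Fˣ) = -1 := by
  rw [sl_ext_iff]
  simp only [sl_neg_apply]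
  simp

theorem pow_four_ne_one_of_orderOf {H : Type*} [Group H]
    {Φ : Matrix.SpecialLinearGroup (Fin 2) F →* H} (hΦ : ∀ M, Φ M = 1 ↔ (M = 1 ∨ M = -1))
    {l : Fˣ} (h : 2 < orderOf (Φ (slDiag l))) : l ^ 4 ≠ 1 := by
  intro h4
  have h1 : l ^ 2 = 1 ∨ l ^ 2 = -1 := by
    have : ((l ^ 2 : Fˣ) : F) ^ 2 = 1 := by
      rw [← Units.val_pow_eq_pow_val, ← pow_mul, h4, Units.val_one]
    rcases sq_eq_one_iff.1 this with h | h
    · left; ext; exact h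
    · right; ext; rw [h]; simp
  have h3 : Φ (slDiag l) ^ 2 = 1 := by
    rw [← map_pow, ← slDiag_pow, hΦ]
    rcases h1 with h1 | h1
    · left; rw [h1, slDiag_one]
    · right; rw [h1, slDiag_neg_one]
  exact absurd (Nat.le_of_dvd two_pos (orderOf_dvd_of_pow_eq_one h3)) (not_le.2 h)

variable [Finite F]

/-- A diagonal element of order `(q - 1) / 2` in `PSL(2, q)` generates the diagonal torus. -/
theorem map_slDiag_mem_zpowers {H : Type*} [Group H]
    {Φ : Matrix.SpecialLinearGroup (Fin 2) F →* H} (hΦ : ∀ M, Φ M = 1 ↔ (M = 1 ∨ M = -1))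
    (h2 : (2 : F) ≠ 0) {q : ℕ} (hq : Nat.card F = q) {l : Fˣ}
    (h : orderOf (Φ (slDiag l)) = (q - 1) / 2) (t : Fˣ) :
    Φ (slDiag t) ∈ Subgroup.zpowers (Φ (slDiag l)) := by
  set f : Fˣ →* H := Φ.comp slDiagHom with hf
  have hfa : ∀ t, f t = Φ (slDiag t) := fun _ => rfl
  have hle : Subgroup.zpowers (f l) ≤ f.range := by
    rw [Subgroup.zpowers_le]; exact ⟨l, rfl⟩
  have : Finite f.range := Finite.of_surjective f.rangeRestrict f.rangeRestrict_surjective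
  -- As -1 is in the kernel, the image of the torus has at most (q-1)/2 elements, which is already
  -- the order of its cyclic subgroup.
  have hker : 2 ≤ Nat.card f.ker := by
    have h1 : (-1 : Fˣ) ∈ f.ker := by
      rw [MonoidHom.mem_ker, hfa, slDiag_neg_one, hΦ]; right; rfl
    have h3 : (⟨-1, h1⟩ : f.ker) ≠ 1 := by
      intro h
      have h4 := congrArg (fun u : f.ker => ((u : Fˣ) : F)) h
      simp at h4
      exact h2 (by linear_combination -h4)
    have : Nontrivial f.ker := ⟨_, _, h3⟩
    exact Finite.one_lt_card
  have hcard : Nat.card f.ker * Nat.card f.range = q - 1 := by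
    rw [← Subgroup.index_ker, Subgroup.card_mul_index, Nat.card_units, hq]
  have heq : Subgroup.zpowers (f l) = f.range := by
    apply Subgroup.eq_of_le_of_card_ge hle
    rw [Nat.card_zpowers, hfa, h, Nat.le_div_iff_mul_le two_pos, ← hcard, mul_comm]
    exact Nat.mul_le_mul_right _ hker
  rw [← hfa, ← hfa, heq]
  exact ⟨t, rfl⟩

end Torus

/-- Twisting Φ by an inner automorphism changes the basis of F² while leaving the design, the group
`G` and the chosen block untouched. -/
theorem IsDihedralAction.comp_conj {F : Type*} [Field F] {P : Type*} {q : ℕ}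
    {𝓑 : Set (Set P)} {G : Subgroup (Equiv.Perm P)}
    {Φ : Matrix.SpecialLinearGroup (Fin 2) F →* Equiv.Perm P} (hΦ : IsDihedralAction q 𝓑 G Φ)
    (h : Matrix.SpecialLinearGroup (Fin 2) F) :
    IsDihedralAction q 𝓑 G (Φ.comp (MulAut.conj h).toMonoidHom) := by
  set Φ' := Φ.comp (MulAut.conj h).toMonoidHom with hΦ'
  have happ : ∀ M, Φ' M = Φ (h * M * h⁻¹) := fun _ => rfl
  have hinv : ∀ M, Φ' (h⁻¹ * M * h) = Φ M := by
    intro M; rw [happ]; congr 1; group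
  have hrange : Φ'.range = Φ.range := by
    ext x
    constructor
    · rintro ⟨M, rfl⟩; exact ⟨_, rfl⟩
    · rintro ⟨M, rfl⟩; exact ⟨_, hinv M⟩
  refine ⟨?_, ?_, ?_, ?_, ?_⟩
  · intro M
    rw [happ, ← mem_center_fin_two_iff M, hΦ.map_eq_one, ← mem_center_fin_two_iff]
    constructor
    · intro hM
      have := Subgroup.Normal.conj_mem inferInstance _ hM h⁻¹
      rwa [show h⁻¹ * (h * M * h⁻¹) * h⁻¹⁻¹ = M by group] at this
    · intro hM
      exact Subgroup.Normal.conj_mem inferInstance _ hM h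
  · intro g hg M
    obtain ⟨M', hM'⟩ := hΦ.normal g hg (h * M * h⁻¹)
    exact ⟨_, by rw [hinv, ← hM', happ]⟩
  · intro x
    obtain ⟨M, h1, h3, h4⟩ := hΦ.point x
    refine ⟨h⁻¹ * M * h, by rw [hinv, h1], by rw [hinv, h3], fun a ha => ?_⟩
    have e1 : Φ' (a * (h⁻¹ * M * h) * a⁻¹) = Φ ((h * a * h⁻¹) * M * (h * a * h⁻¹)⁻¹) := by
      rw [happ]; congr 1; group
    have e2 : Φ' (h⁻¹ * M * h)⁻¹ = Φ M⁻¹ := by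
      rw [happ]; congr 1; group
    rw [e1, e2, hinv]
    exact h4 _ ha
  · intro B hB
    obtain ⟨M, R, h1, h3, h4, h5, h6⟩ := hΦ.block B hB
    refine ⟨h⁻¹ * M * h, h⁻¹ * R * h, by rw [hinv, h1], by rw [hinv, h3], by rw [hinv, h4], ?_, ?_⟩
    · rw [show (h⁻¹ * M * h)⁻¹ = h⁻¹ * M⁻¹ * h by group,
        show h⁻¹ * R * h * (h⁻¹ * M * h) * (h⁻¹ * R * h)⁻¹ = h⁻¹ * (R * M * R⁻¹) * h by group, hinv,
        hinv, h5]
    · rw [hrange, hinv]; exact h6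
  · intro ht B hB C hC
    obtain ⟨M, hM⟩ := hΦ.blocks_transitive (fun x y => by
      obtain ⟨M, hM⟩ := ht x y
      exact ⟨_, hM⟩) B hB C hC
    exact ⟨_, by rw [hinv, hM]⟩

/-- A block can be moved so that its stabilizer is the normalizer of the diagonal torus. -/
theorem IsDihedralAction.exists_torus {F : Type*} [Field F] [Finite F] {P : Type*} {q : ℕ}
    {𝓑 : Set (Set P)} {G : Subgroup (Equiv.Perm P)}
    {Φ : Matrix.SpecialLinearGroup (Fin 2) F →* Equiv.Perm P} (hΦ : IsDihedralAction q 𝓑 G Φ)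
    (hq : Nat.card F = q) (hodd : Odd q) (h5 : 5 < q) (h2 : (2 : F) ≠ 0) {B : Set P}
    (hB : B ∈ 𝓑) :
    ∃ Φ' : Matrix.SpecialLinearGroup (Fin 2) F →* Equiv.Perm P, IsDihedralAction q 𝓑 G Φ' ∧
      (∀ t, Φ' (slDiag t) • B = B) ∧ Φ' (slAnti 1) • B = B ∧
      ∀ g ∈ G, g • B = B → ∃ l μ : Fˣ, μ ^ 4 ≠ 1 ∧ g * Φ' (slDiag l) * g⁻¹ = Φ' (slDiag μ) := by
  obtain ⟨M, R, h1, h3, h4, h6, h7⟩ := hΦ.block B hB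
  obtain ⟨hs, h0⟩ := isSquare_disc_of_orderOf hΦ.map_eq_one hq hodd h5 h2 h1
  obtain ⟨h, l, hl⟩ := exists_conj_slDiag h2 hs h0
  have hΦ' := hΦ.comp_conj h
  set Φ' := Φ.comp (MulAut.conj h).toMonoidHom with hΦd
  have happ : ∀ M, Φ' M = Φ (h * M * h⁻¹) := fun _ => rfl
  have hinv : ∀ M, Φ' (h⁻¹ * M * h) = Φ M := by
    intro M; rw [happ]; congr 1; group
  have hrange : ∀ M, Φ' M ∈ Φ.range := fun M => ⟨_, rfl⟩
  have hlM : Φ' (slDiag l) = Φ M := by rw [← hl, hinv]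
  rw [← hlM] at h1 h3 h7
  have hstab : ∀ σ ∈ Subgroup.zpowers (Φ' (slDiag l)), σ • B = B := by
    intro σ hσ
    have : Subgroup.zpowers (Φ' (slDiag l)) ≤ MulAction.stabilizer (Equiv.Perm P) B := by
      rw [Subgroup.zpowers_le]; exact h3
    exact this hσ
  have hdiag : ∀ t, Φ' (slDiag t) • B = B := fun t =>
    hstab _ (map_slDiag_mem_zpowers hΦ'.map_eq_one h2 hq h1 t)
  have hl4 : 2 < orderOf (Φ' (slDiag l)) := by
    obtain ⟨k, hk⟩ := hodd
    rw [h1]; omega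
  refine ⟨Φ', hΦ', hdiag, ?_, ?_⟩
  · obtain ⟨s, hs⟩ := exists_eq_slAnti_of_conj hΦ'.map_eq_one
      (pow_four_ne_one_of_orderOf hΦ'.map_eq_one hl4) (N := h⁻¹ * R * h) (by
        have e1 : slDiag l⁻¹ = (slDiag l)⁻¹ := map_inv slDiagHom l
        rw [hinv, e1, map_inv, hlM, ← map_inv, ← h6, ← map_mul, ← map_mul]
        congr 1; group)
    have hs' : Φ' (slAnti s) • B = B := by rw [← hs, hinv, h4]
    have e1 : slAnti (1 : Fˣ) = slAnti s * slDiag s := by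
      rw [sl_ext_iff]
      simp only [sl_mul_apply]
      simp
    rw [e1, map_mul, mul_smul, hdiag, hs']
  · intro g hg hgB
    obtain ⟨M', hM'⟩ := hΦ'.normal g hg (slDiag l)
    have ho : orderOf (g * Φ' (slDiag l) * g⁻¹) = orderOf (Φ' (slDiag l)) :=
      MulEquiv.orderOf_eq (MulAut.conj g) _
    -- The conjugate again lies in the block stabilizer of the socle and has order greater than two,
    -- so it is a rotation and hence diagonal.
    have hmem := h7 (g * Φ' (slDiag l) * g⁻¹) (by rw [hM']; exact hrange _) (by
      rw [mul_smul, mul_smul, inv_smul_eq_iff.2 hgB.symm, h3, hgB]) (by rw [ho]; exact hl4)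
    obtain ⟨i, hi⟩ := Subgroup.mem_zpowers_iff.1 hmem
    rw [← map_zpow, ← slDiag_zpow] at hi
    refine ⟨l, l ^ i, ?_, hi.symm⟩
    apply pow_four_ne_one_of_orderOf hΦ'.map_eq_one
    rw [hi, ho]; exact hl4

/-! ### Power sums of Laurent polynomials over the unit group -/

section Moments

variable {F : Type*} [Field F] [Fintype F] [DecidableEq F]

theorem sum_units_pow {i : ℕ} (h0 : 0 < i) (hi : i < Fintype.card F - 1) :
    ∑ y : Fˣ, (y : F) ^ i = 0 := by
  rw [FiniteField.sum_pow_units, if_neg (Nat.not_dvd_of_pos_of_lt h0 hi)]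

theorem sum_units_inv_pow {i : ℕ} (h0 : 0 < i) (hi : i < Fintype.card F - 1) :
    ∑ y : Fˣ, ((y⁻¹ : Fˣ) : F) ^ i = 0 := by
  rw [← sum_units_pow h0 hi]
  exact Equiv.sum_comp (Equiv.inv Fˣ) fun y : Fˣ => (y : F) ^ i

theorem sum_units_const (c : F) : ∑ _y : Fˣ, c = -c := by
  rw [Finset.sum_const, Finset.card_univ, Fintype.card_units, nsmul_eq_mul,
    Nat.cast_sub Fintype.card_pos, FiniteField.cast_card_eq_zero]
  ring

/-- Powers with nonzero exponent smaller than q-1 in absolute value sum to zero over the units, and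
the constant 1 sums to -1; so only the constant term survives, negated. -/
theorem sum_units_sq (hc : 4 < Fintype.card F - 1) (α β γ : F) :
    ∑ y : Fˣ, (α + β * (y : F) ^ 2 + γ * ((y⁻¹ : Fˣ) : F) ^ 2) ^ 2 = -(α ^ 2 + 2 * β * γ) := by
  -- The constant term is made opaque so that `simp` does not distribute the sum over it.
  obtain ⟨c, hc0⟩ : ∃ c, c = α ^ 2 + 2 * β * γ := ⟨_, rfl⟩
  rw [← hc0]
  have h : ∀ y : Fˣ, (α + β * (y : F) ^ 2 + γ * ((y⁻¹ : Fˣ) : F) ^ 2) ^ 2 =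
      c + (2 * α * β) * (y : F) ^ 2 + β ^ 2 * (y : F) ^ 4 +
        (2 * α * γ) * ((y⁻¹ : Fˣ) : F) ^ 2 + γ ^ 2 * ((y⁻¹ : Fˣ) : F) ^ 4 := by
    intro y
    have hy : (y : F) * ((y⁻¹ : Fˣ) : F) = 1 := y.mul_inv
    rw [hc0]
    linear_combination 2 * β * γ * ((y : F) * ((y⁻¹ : Fˣ) : F) + 1) * hy
  simp only [h, Finset.sum_add_distrib, ← Finset.mul_sum]
  rw [sum_units_const, sum_units_pow (by norm_num) (by omega), sum_units_pow (by norm_num) hc,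
    sum_units_inv_pow (by norm_num) (by omega), sum_units_inv_pow (by norm_num) hc]
  ring

theorem sum_units_pow_four (hc : 8 < Fintype.card F - 1) (α β γ : F) :
    ∑ y : Fˣ, (α + β * (y : F) ^ 2 + γ * ((y⁻¹ : Fˣ) : F) ^ 2) ^ 4 =
      -(α ^ 4 + 12 * α ^ 2 * (β * γ) + 6 * (β * γ) ^ 2) := by
  obtain ⟨c, hc0⟩ : ∃ c, c = α ^ 4 + 12 * α ^ 2 * (β * γ) + 6 * (β * γ) ^ 2 := ⟨_, rfl⟩
  rw [← hc0]
  have h : ∀ y : Fˣ, (α + β * (y : F) ^ 2 + γ * ((y⁻¹ : Fˣ) : F) ^ 2) ^ 4 =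
      c +
        (4 * α ^ 3 * β + 12 * α * β ^ 2 * γ) * (y : F) ^ 2 +
        (6 * α ^ 2 * β ^ 2 + 4 * β ^ 3 * γ) * (y : F) ^ 4 +
        (4 * α * β ^ 3) * (y : F) ^ 6 + β ^ 4 * (y : F) ^ 8 +
        (4 * α ^ 3 * γ + 12 * α * γ ^ 2 * β) * ((y⁻¹ : Fˣ) : F) ^ 2 +
        (6 * α ^ 2 * γ ^ 2 + 4 * γ ^ 3 * β) * ((y⁻¹ : Fˣ) : F) ^ 4 +
        (4 * α * γ ^ 3) * ((y⁻¹ : Fˣ) : F) ^ 6 + γ ^ 4 * ((y⁻¹ : Fˣ) : F) ^ 8 := by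
    intro y
    have hy : ((y⁻¹ : Fˣ) : F) = (y : F)⁻¹ := Units.val_inv_eq_inv_val y
    have hy0 : (y : F) ≠ 0 := y.ne_zero
    rw [hy, hc0]
    field_simp
    ring
  simp only [h, Finset.sum_add_distrib, ← Finset.mul_sum]
  rw [sum_units_const, sum_units_pow (by norm_num) (by omega),
    sum_units_pow (by norm_num) (by omega), sum_units_pow (by norm_num) (by omega),
    sum_units_pow (by norm_num) hc, sum_units_inv_pow (by norm_num) (by omega),
    sum_units_inv_pow (by norm_num) (by omega), sum_units_inv_pow (by norm_num) (by omega),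
    sum_units_inv_pow (by norm_num) hc]
  ring

end Moments

/-! ### Decomposition of a block into two torus orbits -/

section Orbits

variable {F : Type*} [Field F]

/-- The sign attached to a Boolean. -/
def boolSign (ε : Bool) : F := cond ε 1 (-1)

/-- The value of the trace form on two vectors moved relative to each other by a diagonal
element. -/
def torusForm (X Y : Matrix (Fin 2) (Fin 2) F) (y : Fˣ) : F :=
  2 * X 0 0 * Y 0 0 + X 0 1 * Y 1 0 * (y : F) ^ 2 + X 1 0 * Y 0 1 * ((y⁻¹ : Fˣ) : F) ^ 2

/-- The vectors in two torus orbits, up to sign. -/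
def torusOrbits (X Y : Matrix (Fin 2) (Fin 2) F) (k : Bool × Bool × Fˣ) :
    Matrix (Fin 2) (Fin 2) F :=
  (boolSign k.2.1 : F) • slConj (slDiag k.2.2) (cond k.1 X Y)

theorem torusForm_inv (X Y : Matrix (Fin 2) (Fin 2) F) (y : Fˣ) :
    torusForm X Y y⁻¹ = torusForm Y X y := by
  simp only [torusForm, inv_inv]
  ring

theorem trace_torus_mul {X Y : Matrix (Fin 2) (Fin 2) F} (hX : X 1 1 = -X 0 0)
    (hY : Y 1 1 = -Y 0 0) (ε ε' : F) (s t : Fˣ) :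
    ((ε • slConj (slDiag s) X) * (ε' • slConj (slDiag t) Y)).trace =
      ε * ε' * torusForm X Y (s / t) := by
  rw [Matrix.smul_mul, Matrix.mul_smul, Matrix.trace_smul, Matrix.trace_smul, slConj_slDiag,
    slConj_slDiag, trace_mul_fin_two, torusForm]
  simp [hX, hY]
  field_simp
  ring

/-- The sum of an even function over the pairs of vectors of a set that consists of two torus
orbits. -/
theorem sum_torusForm [Fintype F] [DecidableEq F] {n : F} {q : ℕ} (hq : Nat.card F = q)
    {V : Finset (Matrix (Fin 2) (Fin 2) F)} {X Y : Matrix (Fin 2) (Fin 2) F}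
    (hX : X 1 1 = -X 0 0) (hY : Y 1 1 = -Y 0 0) {R : Type*} [CommRing R] [IsDomain R]
    (hR2 : (2 : R) ≠ 0) (hRq : (q : R) - 1 ≠ 0)
    (hsum : ∀ g : Matrix (Fin 2) (Fin 2) F → R,
      ∑ k : Bool × Bool × Fˣ, g (torusOrbits X Y k) = 2 * ∑ Z ∈ V, g Z)
    (f : F → R) (hf : ∀ e, f (-e) = f e)
    (hV : ∑ Z ∈ V, ∑ W ∈ V, f (Z * W).trace =
      4 * (q - 1) * ∑ e, f e - 2 * (q - 1) * (f (2 * n) + f (-(2 * n)))) :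
    (∑ y, f (torusForm X X y)) + 2 * (∑ y, f (torusForm X Y y)) + ∑ y, f (torusForm Y Y y) =
      4 * ∑ e, f e - 4 * f (2 * n) := by
  have hcardU : ((Fintype.card Fˣ : ℕ) : R) = q - 1 := by
    rw [Fintype.card_units, Nat.cast_sub Fintype.card_pos, ← hq, Nat.card_eq_fintype_card,
      Nat.cast_one]
  have hdiv : ∀ h : Fˣ → R, ∑ s : Fˣ, ∑ t : Fˣ, h (s / t) = (q - 1) * ∑ y, h y := by
    intro h
    rw [Finset.sum_comm]
    have : ∀ t : Fˣ, ∑ s : Fˣ, h (s / t) = ∑ y, h y := fun t =>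
      Equiv.sum_comp (Equiv.divRight t) h
    rw [Finset.sum_congr rfl fun t _ => this t, Finset.sum_const, Finset.card_univ, nsmul_eq_mul,
      hcardU]
  have hsign : ∀ (ε ε' : Bool) (e : F), f (boolSign ε * boolSign ε' * e) = f e := by
    intro ε ε' e
    cases ε <;> cases ε' <;> simp [boolSign, hf]
  have hpair : ∀ Z W : Matrix (Fin 2) (Fin 2) F, Z 1 1 = -Z 0 0 → W 1 1 = -W 0 0 →
      ∀ ε ε' : Bool, ∑ s : Fˣ, ∑ t : Fˣ, f (((boolSign ε : F) • slConj (slDiag s) Z) *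
        ((boolSign ε' : F) • slConj (slDiag t) W)).trace =
        (q - 1) * ∑ y, f (torusForm Z W y) := by
    intro Z W hZ hW ε ε'
    simp only [trace_torus_mul hZ hW, hsign]
    exact hdiv fun y => f (torusForm Z W y)
  have hYX : ∑ y, f (torusForm Y X y) = ∑ y, f (torusForm X Y y) := by
    rw [← Equiv.sum_comp (Equiv.inv Fˣ)]
    refine Finset.sum_congr rfl fun y _ => ?_
    rw [Equiv.inv_apply, torusForm_inv]
  -- Each vector of V is enumerated twice, by t and -t, whence the factor 4 for pairs.
  have h4 : ∑ k : Bool × Bool × Fˣ, ∑ k' : Bool × Bool × Fˣ,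
      f (torusOrbits X Y k * torusOrbits X Y k').trace =
      4 * ∑ Z ∈ V, ∑ W ∈ V, f (Z * W).trace := by
    have h1 : ∀ Z : Matrix (Fin 2) (Fin 2) F, ∑ k' : Bool × Bool × Fˣ,
        f (Z * torusOrbits X Y k').trace = 2 * ∑ W ∈ V, f (Z * W).trace :=
      fun Z => hsum fun W => f (Z * W).trace
    simp only [h1]
    rw [hsum fun Z => 2 * ∑ W ∈ V, f (Z * W).trace, ← Finset.mul_sum]
    ring
  have h5 : ∑ k : Bool × Bool × Fˣ, ∑ k' : Bool × Bool × Fˣ,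
      f (torusOrbits X Y k * torusOrbits X Y k').trace =
      4 * (q - 1) * ((∑ y, f (torusForm X X y)) + 2 * (∑ y, f (torusForm X Y y)) +
        ∑ y, f (torusForm Y Y y)) := by
    simp only [torusOrbits, Fintype.sum_prod_type, Fintype.sum_bool, cond_true, cond_false,
      Finset.sum_add_distrib, hpair _ _ hX hX, hpair _ _ hX hY, hpair _ _ hY hX, hpair _ _ hY hY,
      hYX]
    ring
  rw [h5, hV, hf] at h4
  have h44 : (4 : R) ≠ 0 := by rw [show (4 : R) = 2 * 2 by norm_num]; exact mul_ne_zero hR2 hR2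
  apply mul_left_cancel₀ (mul_ne_zero h44 hRq)
  linear_combination h4

end Orbits

section Orbits

variable {F : Type*} [Field F]

theorem boolSign_mul_self (ε : Bool) : (boolSign ε : F) * boolSign ε = 1 := by
  cases ε <;> simp [boolSign]

theorem boolSign_injective (h2 : (2 : F) ≠ 0) {ε ε' : Bool}
    (h : (boolSign ε : F) = boolSign ε') : ε = ε' := by
  cases ε <;> cases ε' <;> simp [boolSign] at h ⊢
  · exact h2 (by linear_combination -h)
  · exact h2 (by linear_combination h)

theorem slConj_smul (h : Matrix.SpecialLinearGroup (Fin 2) F) (c : F)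
    (X : Matrix (Fin 2) (Fin 2) F) : slConj h (c • X) = c • slConj h X := by
  simp [slConj]

/-- The hypotheses on the vectors of a block that is invariant under the normalizer of the diagonal
torus. -/
structure IsTorusInvariant (n : F) (q : ℕ) (V : Finset (Matrix (Fin 2) (Fin 2) F)) : Prop where
  isInner : ∀ X ∈ V, IsInner n X
  card : V.card = 2 * (q - 1)
  neg_mem : ∀ X ∈ V, -X ∈ V
  diag_mem : ∀ t, ∀ X ∈ V, slConj (slDiag t) X ∈ V
  anti_mem : ∀ X ∈ V, slConj (slAnti 1) X ∈ V
  exists_ringHom : ∀ X ∈ V, ∀ Y ∈ V, ∃ σ : F →+* F, Y 0 0 ^ 2 * σ n = n * σ (X 0 0 ^ 2)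

variable {n : F} {q : ℕ} {V : Finset (Matrix (Fin 2) (Fin 2) F)}

theorem IsTorusInvariant.smul_mem (hV : IsTorusInvariant n q V) {X : Matrix (Fin 2) (Fin 2) F}
    (hX : X ∈ V) (ε : Bool) : (boolSign ε : F) • X ∈ V := by
  cases ε
  · simpa [boolSign] using hV.neg_mem X hX
  · simpa [boolSign] using hX

theorem eq_of_smul_slConj_slDiag_eq (h2 : (2 : F) ≠ 0) (hn : ¬ IsSquare n)
    {Z : Matrix (Fin 2) (Fin 2) F} (hZ : IsInner n Z) (hZ0 : Z 0 0 ≠ 0) {ε ε' : Bool} {t t' : Fˣ}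
    (h : (boolSign ε : F) • slConj (slDiag t) Z = (boolSign ε' : F) • slConj (slDiag t') Z) :
    ε' = ε ∧ (t' = t ∨ t' = -t) := by
  have h00 := congrFun (congrFun h 0) 0
  have h01 := congrFun (congrFun h 0) 1
  simp only [slConj_slDiag, Matrix.smul_apply, smul_eq_mul] at h00 h01
  simp at h00 h01
  have hε := boolSign_injective h2 (h00.resolve_right hZ0)
  subst hε
  have hs : (boolSign ε : F) ≠ 0 := left_ne_zero_of_mul_eq_one (boolSign_mul_self ε)
  have hb := hZ.upper_right_ne_zero hn
  have h1 := mul_right_cancel₀ hb (mul_left_cancel₀ hs h01)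
  refine ⟨rfl, ?_⟩
  rcases sq_eq_sq_iff_eq_or_eq_neg.1 h1 with h3 | h3
  · left; ext; exact h3.symm
  · right; ext; rw [Units.val_neg, h3, neg_neg]

theorem slConj_slDiag_neg (t : Fˣ) (Z : Matrix (Fin 2) (Fin 2) F) :
    slConj (slDiag (-t)) Z = slConj (slDiag t) Z := by
  rw [slConj_slDiag, slConj_slDiag]
  simp

variable [Fintype F] [DecidableEq F]

/-- One vanishing X₀₀ would make all of them vanish, by the relation through σ. Such vectors are
determined by X₀₁ ≠ 0, so there are at most q-1 of them, fewer than |V|. -/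
theorem IsTorusInvariant.upper_left_ne_zero (hV : IsTorusInvariant n q V) (hq : Nat.card F = q)
    (h1q : 1 < q) (hn : ¬ IsSquare n) : ∀ X ∈ V, X 0 0 ≠ 0 := by
  have hn0 : n ≠ 0 := fun h => hn (h ▸ IsSquare.zero)
  intro X hX h0
  have hall : ∀ Y ∈ V, Y 0 0 = 0 := by
    intro Y hY
    obtain ⟨σ, hσ⟩ := hV.exists_ringHom X hX Y hY
    rw [h0, zero_pow two_ne_zero, map_zero, mul_zero] at hσ
    exact pow_eq_zero_iff two_ne_zero |>.1
      ((mul_eq_zero.1 hσ).resolve_right ((map_ne_zero σ).2 hn0))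
  have hcard : V.card ≤ (Finset.univ.erase (0 : F)).card := by
    refine Finset.card_le_card_of_injOn (fun Y => Y 0 1) ?_ ?_
    · intro Y hY
      simpa using (hV.isInner Y hY).upper_right_ne_zero hn
    · intro Y hY Z hZ hYZ
      have hYZ' : Y 0 1 = Z 0 1 := hYZ
      have h1 := hV.isInner Y hY
      have h2 := hV.isInner Z hZ
      have hb := h2.upper_right_ne_zero hn
      apply matrix_fin_two_ext
      · rw [hall Y hY, hall Z hZ]
      · exact hYZ
      · apply mul_left_cancel₀ hb
        have e1 := h1.2
        have e2 := h2.2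
        rw [hall Y hY, hYZ'] at e1
        rw [hall Z hZ] at e2
        linear_combination e1 - e2
      · rw [h1.1, h2.1, hall Y hY, hall Z hZ]
  rw [Finset.card_erase_of_mem (Finset.mem_univ _), Finset.card_univ, ← Nat.card_eq_fintype_card,
    hq, hV.card] at hcard
  omega

/-- A torus-invariant set of vectors consists, up to sign, of two torus orbits. -/
theorem IsTorusInvariant.exists_two_orbits (hV : IsTorusInvariant n q V) (hq : Nat.card F = q)
    (h1q : 1 < q) (h2 : (2 : F) ≠ 0) (hn : ¬ IsSquare n) :
    ∃ X ∈ V, ∃ Y ∈ V, (∀ k, torusOrbits X Y k ∈ V) ∧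
      ∀ Z ∈ V, (Finset.univ.filter fun k => torusOrbits X Y k = Z).card = 2 := by
  have hne := hV.upper_left_ne_zero hq h1q hn
  have htne : ∀ t : Fˣ, -t ≠ t := by
    intro t h
    have h1 := congrArg (fun u : Fˣ => (u : F)) h
    simp only [Units.val_neg] at h1
    exact mul_ne_zero h2 t.ne_zero (by linear_combination -h1)
  have hU : Fintype.card Fˣ = q - 1 := by
    rw [Fintype.card_units, ← Nat.card_eq_fintype_card, hq]
  obtain ⟨X, hX⟩ : V.Nonempty := by
    rw [← Finset.card_pos, hV.card]; omega
  set p : Bool × Fˣ → Matrix (Fin 2) (Fin 2) F :=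
    fun k => (boolSign k.1 : F) • slConj (slDiag k.2) X with hp
  -- The parametrization of a signed orbit is at least two-to-one, so one orbit has at most q-1
  -- vectors and cannot fill V.
  have himg : 2 * (Finset.univ.image p).card ≤ (Finset.univ : Finset (Bool × Fˣ)).card := by
    apply Finset.mul_card_image_le_card
    intro b hb
    obtain ⟨⟨ε, t⟩, -, rfl⟩ := Finset.mem_image.1 hb
    have hsub : {(ε, t), (ε, -t)} ⊆ Finset.univ.filter fun k => p k = p (ε, t) := by
      intro k hk
      rw [Finset.mem_insert, Finset.mem_singleton] at hk
      rcases hk with rfl | rfl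
      · simp
      · simp [hp, slConj_slDiag_neg]
    refine le_trans (le_of_eq ?_) (Finset.card_le_card hsub)
    rw [Finset.card_pair]
    intro h
    exact htne t (congrArg Prod.snd h).symm
  rw [Finset.card_univ, Fintype.card_prod, Fintype.card_bool, hU] at himg
  obtain ⟨Y, hY, hYp⟩ : ∃ Y ∈ V, Y ∉ Finset.univ.image p := by
    by_contra! hcon
    have h1 : V.card ≤ (Finset.univ.image p).card := Finset.card_le_card hcon
    rw [hV.card] at h1
    omega
  have hmem : ∀ k, torusOrbits X Y k ∈ V := by
    rintro ⟨i, ε, t⟩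
    apply hV.smul_mem
    apply hV.diag_mem
    cases i <;> assumption
  have hcross : ∀ ε ε' : Bool, ∀ t t' : Fˣ, (boolSign ε : F) • slConj (slDiag t) X ≠
      (boolSign ε' : F) • slConj (slDiag t') Y := by
    intro ε ε' t t' h
    apply hYp
    have h1 := congrArg (fun Z => (boolSign ε' : F) • slConj (slDiag t')⁻¹ Z) h
    simp only [slConj_smul, slConj_inv_slConj, smul_smul, boolSign_mul_self, one_smul] at h1
    rw [← slConj_mul] at h1
    have e1 : (slDiag t')⁻¹ = slDiag t'⁻¹ := (map_inv slDiagHom t').symm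
    rw [e1, ← slDiag_mul] at h1
    rw [Finset.mem_image, ← h1]
    refine ⟨(ε == ε', t'⁻¹ * t), Finset.mem_univ _, ?_⟩
    simp only [hp]
    congr 1
    cases ε <;> cases ε' <;> simp [boolSign]
  have hinj : ∀ i ε t i' ε' t', torusOrbits X Y (i, ε, t) = torusOrbits X Y (i', ε', t') →
      i' = i ∧ ε' = ε ∧ (t' = t ∨ t' = -t) := by
    intro i ε t i' ε' t' h
    cases i <;> cases i' <;> simp only [torusOrbits, cond_true, cond_false] at h
    · exact ⟨rfl, eq_of_smul_slConj_slDiag_eq h2 hn (hV.isInner Y hY) (hne Y hY) h⟩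
    · exact absurd h.symm (hcross _ _ _ _)
    · exact absurd h (hcross _ _ _ _)
    · exact ⟨rfl, eq_of_smul_slConj_slDiag_eq h2 hn (hV.isInner X hX) (hne X hX) h⟩
  have hfib : ∀ b ∈ V, (Finset.univ.filter fun k => torusOrbits X Y k = b).card ≤ 2 := by
    intro b _
    rcases (Finset.univ.filter fun k => torusOrbits X Y k = b).eq_empty_or_nonempty with
      h0 | ⟨k, hk⟩
    · simp [h0]
    · obtain ⟨i, ε, t⟩ := k
      refine (Finset.card_le_card (t := {(i, ε, t), (i, ε, -t)}) ?_).trans Finset.card_le_two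
      rintro ⟨i', ε', t'⟩ hk'
      have e1 := (Finset.mem_filter.1 hk).2
      have e2 := (Finset.mem_filter.1 hk').2
      obtain ⟨rfl, rfl, h | h⟩ := hinj _ _ _ _ _ _ (e1.trans e2.symm) <;> simp [h]
  have hsum : ∑ b ∈ V, (Finset.univ.filter fun k => torusOrbits X Y k = b).card = ∑ _b ∈ V, 2 := by
    rw [← Finset.card_eq_sum_card_fiberwise (f := torusOrbits X Y) (s := Finset.univ) (t := V)
      (fun k _ => hmem k), Finset.card_univ, Finset.sum_const, hV.card, Fintype.card_prod,
      Fintype.card_prod, Fintype.card_bool, hU, smul_eq_mul]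
    ring
  exact ⟨X, hX, Y, hY, hmem, (Finset.sum_eq_sum_iff_of_le hfib).1 hsum⟩

theorem sum_torusOrbits {X Y : Matrix (Fin 2) (Fin 2) F} (hmem : ∀ k, torusOrbits X Y k ∈ V)
    (hfib : ∀ Z ∈ V, (Finset.univ.filter fun k => torusOrbits X Y k = Z).card = 2)
    {R : Type*} [CommRing R] (g : Matrix (Fin 2) (Fin 2) F → R) :
    ∑ k : Bool × Bool × Fˣ, g (torusOrbits X Y k) = 2 * ∑ Z ∈ V, g Z := by
  rw [← Finset.sum_fiberwise_of_maps_to (s := Finset.univ) (t := V) (g := torusOrbits X Y)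
    (fun k _ => hmem k) (fun k => g (torusOrbits X Y k)), Finset.mul_sum]
  refine Finset.sum_congr rfl fun b hb => ?_
  rw [Finset.sum_congr rfl (g := fun _ => g b) (fun k hk => by rw [(Finset.mem_filter.1 hk).2]),
    Finset.sum_const, hfib b hb, nsmul_eq_mul, Nat.cast_ofNat]

/-- The products of the off-diagonal coordinates of the representatives of the two orbits lie in
the same square class. -/
theorem isSquare_mul_of_two_orbits {X Y : Matrix (Fin 2) (Fin 2) F}
    (hV : IsTorusInvariant n q V) (hX : X ∈ V) (hY : Y ∈ V) (hX0 : X 0 0 ≠ 0) (hY0 : Y 0 0 ≠ 0)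
    (hfib : ∀ Z ∈ V, (Finset.univ.filter fun k => torusOrbits X Y k = Z).card = 2) :
    IsSquare (X 0 1 * X 1 0 * (Y 0 1 * Y 1 0)) := by
  have hk : ∀ Z ∈ V, ∃ k, torusOrbits X Y k = Z := by
    intro Z hZ
    obtain ⟨k, hk⟩ := Finset.card_pos.1 (by rw [hfib Z hZ]; exact two_pos)
    exact ⟨k, (Finset.mem_filter.1 hk).2⟩
  have key : ∀ Z ∈ V, ∀ W ∈ V, Z 0 0 ≠ 0 → (∀ U ∈ V, ∃ (ε : Bool) (t : Fˣ),
      (boolSign ε : F) • slConj (slDiag t) Z = U ∨ (boolSign ε : F) • slConj (slDiag t) W = U) →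
      IsSquare (Z 0 1 * Z 1 0) ∨ Z 0 1 * Z 1 0 = W 0 1 * W 1 0 := by
    intro Z hZ W hW hZ0 hU
    have hZ1 := (hV.isInner Z hZ).1
    -- The negative of the antidiagonal conjugate of Z is its transpose. If the transpose lies in
    -- the orbit of Z, then Z₁₀ = t²Z₀₁; if it lies in that of W, the off-diagonal products agree.
    obtain ⟨ε, t, h | h⟩ := hU _ (hV.neg_mem _ (hV.anti_mem Z hZ))
    · left
      have h00 := congrFun (congrFun h 0) 0
      have h01 := congrFun (congrFun h 0) 1
      simp only [slConj_slDiag, slConj_slAnti, Matrix.smul_apply, smul_eq_mul,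
        Matrix.neg_apply] at h00 h01
      simp [hZ1] at h00 h01
      rw [mul_right_cancel₀ hZ0 (h00.trans (one_mul _).symm), one_mul] at h01
      exact ⟨t * Z 0 1, by rw [← h01]; ring⟩
    · right
      have h01 := congrFun (congrFun h 0) 1
      have h10 := congrFun (congrFun h 1) 0
      simp only [slConj_slDiag, slConj_slAnti, Matrix.smul_apply, smul_eq_mul,
        Matrix.neg_apply] at h01 h10
      simp at h01 h10
      have hε := boolSign_mul_self (F := F) ε
      have ht : (t : F) ≠ 0 := t.ne_zero
      rw [← h01, ← h10]
      field_simp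
      linear_combination (W 0 1 * W 1 0) * hε
  have hXY := key X hX Y hY hX0 (by
    intro U hU
    obtain ⟨⟨i, ε, t⟩, h⟩ := hk U hU
    refine ⟨ε, t, ?_⟩
    cases i
    · right; exact h
    · left; exact h)
  have hYX := key Y hY X hX hY0 (by
    intro U hU
    obtain ⟨⟨i, ε, t⟩, h⟩ := hk U hU
    refine ⟨ε, t, ?_⟩
    cases i
    · left; exact h
    · right; exact h)
  rcases hXY with h | h
  · rcases hYX with h' | h'
    · exact h.mul h'
    · rw [h']; exact ⟨_, rfl⟩
  · rw [h]; exact ⟨_, rfl⟩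

end Orbits

/-! ### Zeros of the trace form, moments, and the contradiction -/

section Zeros

theorem twentyfive_le_card_of_five_eq_zero {F : Type*} [Field F] [Fintype F]
    (h5 : (5 : F) = 0) (hc : 5 < Fintype.card F) :
    25 ≤ Fintype.card F := by
  obtain ⟨k, hp, hk⟩ := FiniteField.card F (ringChar F)
  have hr : ringChar F = 5 :=
    (Nat.prime_dvd_prime_iff_eq hp Nat.prime_five).1 (ringChar.dvd (by exact_mod_cast h5))
  rw [hr] at hk
  have hk2 : 2 ≤ (k : ℕ) := by
    by_contra! h
    have : 5 ^ (k : ℕ) ≤ 5 ^ 1 := Nat.pow_le_pow_right (by norm_num) (by omega)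
    omega
  have : 5 ^ 2 ≤ 5 ^ (k : ℕ) := Nat.pow_le_pow_right (by norm_num) hk2
  omega

variable {F : Type*} [Field F] [Fintype F] [DecidableEq F] {n : F} {q : ℕ}
  {V : Finset (Matrix (Fin 2) (Fin 2) F)} {X Y : Matrix (Fin 2) (Fin 2) F}

/-- The zeros of the trace form along a pair of torus orbits. -/
def torusZeros (X Y : Matrix (Fin 2) (Fin 2) F) : Finset Fˣ :=
  Finset.univ.filter fun y => torusForm X Y y = 0

theorem mem_torusZeros {y : Fˣ} : y ∈ torusZeros X Y ↔ torusForm X Y y = 0 := by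
  simp [torusZeros]

theorem neg_mem_torusZeros {y : Fˣ} (hy : y ∈ torusZeros X Y) : -y ∈ torusZeros X Y := by
  rw [mem_torusZeros] at hy ⊢
  rw [← hy, torusForm, torusForm, inv_neg, Units.val_neg, Units.val_neg, neg_sq, neg_sq]

theorem inv_mem_torusZeros {y : Fˣ} (hy : y ∈ torusZeros X X) : y⁻¹ ∈ torusZeros X X := by
  rw [mem_torusZeros] at hy ⊢
  rw [torusForm_inv, hy]

theorem eq_or_eq_neg_of_mem_torusZeros (h2 : (2 : F) ≠ 0) (hc : (torusZeros X Y).card ≤ 2)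
    {y z : Fˣ} (hy : y ∈ torusZeros X Y) (hz : z ∈ torusZeros X Y) : z = y ∨ z = -y := by
  by_contra! hcon
  have hne : y ≠ -y := by
    intro h
    have h1 := congrArg (fun u : Fˣ => (u : F)) h
    simp only [Units.val_neg] at h1
    exact mul_ne_zero h2 y.ne_zero (by linear_combination h1)
  have h3 : ({z, y, -y} : Finset Fˣ).card = 3 :=
    Finset.card_eq_three.2 ⟨z, y, -y, hcon.1, hcon.2, hne, rfl⟩
  have hsub : ({z, y, -y} : Finset Fˣ) ⊆ torusZeros X Y := by
    intro w hw
    simp only [Finset.mem_insert, Finset.mem_singleton] at hw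
    rcases hw with rfl | rfl | rfl
    · exact hz
    · exact hy
    · exact neg_mem_torusZeros hy
  have := Finset.card_le_card hsub
  omega

/-- Divided by n, the form is 2ρ + (1-ρ)(y² + y⁻²) with ρ = X₀₀²/n, and σ carries ρ for X to ρ for
Y; so σ maps zeros to zeros. -/
theorem card_torusZeros_le (hX : IsInner n X) (hY : IsInner n Y) (hn : n ≠ 0) {σ : F →+* F}
    (hσ : Y 0 0 ^ 2 * σ n = n * σ (X 0 0 ^ 2)) :
    (torusZeros X X).card ≤ (torusZeros Y Y).card := by
  refine Finset.card_le_card_of_injOn (Units.map (σ : F →* F)) ?_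
    ((Units.map_injective σ.injective).injOn)
  intro y hy
  have hy := mem_torusZeros.1 hy
  refine mem_torusZeros.2 ?_
  have hσn : σ n ≠ 0 := (map_ne_zero σ).2 hn
  have h1 : σ (2 * X 0 0 ^ 2 + (n - X 0 0 ^ 2) * ((y : F) ^ 2 + ((y⁻¹ : Fˣ) : F) ^ 2)) = 0 := by
    rw [← map_zero σ, ← hy, torusForm, ← hX.2]
    congr 1
    ring
  have hval : ((Units.map (σ : F →* F) y)⁻¹ : Fˣ) = Units.map (σ : F →* F) y⁻¹ := (map_inv _ _).symm
  rw [torusForm, hval, Units.coe_map, Units.coe_map]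
  simp only [map_add, map_mul, map_sub, map_ofNat, MonoidHom.coe_coe] at h1 ⊢
  rw [map_pow σ (y : F), map_pow σ ((y⁻¹ : Fˣ) : F)] at h1
  apply mul_left_cancel₀ hσn
  have h2 := hY.2
  linear_combination n * h1 + (2 - σ y ^ 2 - σ ((y⁻¹ : Fˣ) : F) ^ 2) * hσ +
    σ n * (σ y ^ 2 + σ ((y⁻¹ : Fˣ) : F) ^ 2) * h2

/-- The zeros are ±y and are closed under inversion, so y² = ±1. The value at y² = 1 is 2n ≠ 0, and
y² = -1 gives the claim. -/
theorem eq_two_mul_sq_of_mem_torusZeros (h2 : (2 : F) ≠ 0) (hn : n ≠ 0) (hX : IsInner n X)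
    (hc : (torusZeros X X).card ≤ 2) {y : Fˣ} (hy : y ∈ torusZeros X X) :
    n = 2 * X 0 0 ^ 2 := by
  have hinv := eq_or_eq_neg_of_mem_torusZeros h2 hc hy (inv_mem_torusZeros hy)
  have h0 := mem_torusZeros.1 hy
  have hyy : (y : F) * ((y⁻¹ : Fˣ) : F) = 1 := y.mul_inv
  have hX2 := hX.2
  rw [torusForm] at h0
  apply mul_left_cancel₀ h2
  rcases hinv with h | h
  · rw [h] at h0 hyy
    exact absurd (by linear_combination h0 - 2 * X 0 1 * X 1 0 * hyy - 2 * hX2)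
      (mul_ne_zero h2 hn)
  · rw [h, Units.val_neg] at h0 hyy
    linear_combination -h0 - 2 * X 0 1 * X 1 0 * hyy - 2 * hX2

/-- With βγ = s², the substitution y ↦ (s/β)y⁻¹ exchanges the terms βy² and γy⁻² and so preserves
the zeros. Since only ±y are available, the two terms are equal at y, and squaring the equation
gives X₀₀²Y₀₀² = (n - X₀₀²)(n - Y₀₀²). -/
theorem add_sq_eq_of_mem_torusZeros (h2 : (2 : F) ≠ 0) (hn : ¬ IsSquare n) (hX : IsInner n X)
    (hY : IsInner n Y) (hsq : IsSquare (X 0 1 * X 1 0 * (Y 0 1 * Y 1 0)))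
    (hc : (torusZeros X Y).card ≤ 2) {y : Fˣ} (hy : y ∈ torusZeros X Y) :
    n = X 0 0 ^ 2 + Y 0 0 ^ 2 := by
  have hn0 : n ≠ 0 := fun h => hn (h ▸ IsSquare.zero)
  obtain ⟨s, hs⟩ := hsq
  obtain ⟨β, hβ⟩ : ∃ β, β = X 0 1 * Y 1 0 := ⟨_, rfl⟩
  obtain ⟨γ, hγ⟩ : ∃ γ, γ = X 1 0 * Y 0 1 := ⟨_, rfl⟩
  have hβγ : β * γ = s * s := by rw [hβ, hγ, ← hs]; ring
  have hX2 := hX.2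
  have hY2 := hY.2
  have hm : X 0 1 * X 1 0 ≠ 0 := fun h => hn ⟨X 0 0, by rw [← hX2, h]; ring⟩
  have hm' : Y 0 1 * Y 1 0 ≠ 0 := fun h => hn ⟨Y 0 0, by rw [← hY2, h]; ring⟩
  have hs0 : s ≠ 0 := left_ne_zero_of_mul (hs ▸ mul_ne_zero hm hm')
  have hβ0 : β ≠ 0 := left_ne_zero_of_mul (hβγ ▸ mul_ne_zero hs0 hs0)
  have hy0 : (y : F) ≠ 0 := y.ne_zero
  have h0 := mem_torusZeros.1 hy
  have hz : Units.mk0 (s / β) (div_ne_zero hs0 hβ0) * y⁻¹ ∈ torusZeros X Y := by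
    rw [mem_torusZeros, ← h0, torusForm, torusForm, ← hβ, ← hγ]
    simp only [mul_inv, inv_inv, Units.val_mul, Units.val_inv_eq_inv_val, Units.val_mk0]
    field_simp
    linear_combination (β ^ 2 * y ^ 4 - s ^ 2) * hβγ
  rw [torusForm, ← hβ, ← hγ, Units.val_inv_eq_inv_val] at h0
  have hsy : s ^ 2 = (β * y ^ 2) ^ 2 := by
    rcases eq_or_eq_neg_of_mem_torusZeros h2 hc hy hz with h | h
    · have h1 := congrArg (fun u : Fˣ => (u : F)) h
      simp only [Units.val_mul, Units.val_inv_eq_inv_val, Units.val_mk0] at h1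
      field_simp at h1
      rw [h1]
    · have h1 := congrArg (fun u : Fˣ => (u : F)) h
      simp only [Units.val_mul, Units.val_inv_eq_inv_val, Units.val_mk0, Units.val_neg] at h1
      field_simp at h1
      rw [h1]; ring
  have hγy : γ * (y : F)⁻¹ ^ 2 = β * y ^ 2 := by
    have h1 : γ = β * y ^ 4 := mul_left_cancel₀ hβ0 (by linear_combination hβγ + hsy)
    rw [h1]
    field_simp
  rw [hγy] at h0
  have h3 : X 0 0 * Y 0 0 = -(β * y ^ 2) :=
    mul_left_cancel₀ h2 (by linear_combination h0)
  have h4 : X 0 0 ^ 2 * Y 0 0 ^ 2 = X 0 1 * X 1 0 * (Y 0 1 * Y 1 0) := by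
    rw [hs, ← mul_pow, h3]
    linear_combination -hsy
  apply mul_left_cancel₀ hn0
  linear_combination -h4 - X 0 1 * X 1 0 * hY2 - (n - Y 0 0 ^ 2) * hX2

/-- The indicator of 0 shows that the zeros of the forms XX, XY, XY, YY number 4 in total. XX and YY
have equally many, so either both have zeros, or XY has exactly two. -/
theorem IsTorusInvariant.add_sq_eq (hV : IsTorusInvariant n q V) (h2 : (2 : F) ≠ 0)
    (hn : ¬ IsSquare n) (hX : X ∈ V) (hY : Y ∈ V)
    (hsq : IsSquare (X 0 1 * X 1 0 * (Y 0 1 * Y 1 0)))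
    (hmom : ∀ f : F → ℤ, (∀ e, f (-e) = f e) →
      (∑ y, f (torusForm X X y)) + 2 * (∑ y, f (torusForm X Y y)) + ∑ y, f (torusForm Y Y y) =
        4 * ∑ e, f e - 4 * f (2 * n)) :
    n = X 0 0 ^ 2 + Y 0 0 ^ 2 := by
  have hn0 : n ≠ 0 := fun h => hn (h ▸ IsSquare.zero)
  have hXi := hV.isInner X hX
  have hYi := hV.isInner Y hY
  have hcount : (torusZeros X X).card + 2 * (torusZeros X Y).card + (torusZeros Y Y).card = 4 := by
    have h := hmom (fun e => if e = 0 then 1 else 0) (fun e => by simp)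
    have h2n : 2 * n ≠ 0 := mul_ne_zero h2 hn0
    simp only [Finset.sum_boole, if_neg h2n, Finset.filter_eq', Finset.mem_univ, if_true,
      Finset.card_singleton] at h
    simp only [torusZeros]
    push_cast at h
    omega
  obtain ⟨σ, hσ⟩ := hV.exists_ringHom X hX Y hY
  obtain ⟨τ, hτ⟩ := hV.exists_ringHom Y hY X hX
  have hle := card_torusZeros_le hXi hYi hn0 hσ
  have hge := card_torusZeros_le hYi hXi hn0 hτ
  rcases (torusZeros X X).eq_empty_or_nonempty with h0 | ⟨y, hy⟩
  · rw [h0, Finset.card_empty] at hge hcount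
    obtain ⟨y, hy⟩ : (torusZeros X Y).Nonempty := Finset.card_pos.1 (by omega)
    exact add_sq_eq_of_mem_torusZeros h2 hn hXi hYi hsq (by omega) hy
  · have hpos := Finset.card_pos.2 ⟨y, hy⟩
    obtain ⟨z, hz⟩ : (torusZeros Y Y).Nonempty := Finset.card_pos.1 (by omega)
    have h3 := eq_two_mul_sq_of_mem_torusZeros h2 hn0 hXi (by omega) hy
    have h4 := eq_two_mul_sq_of_mem_torusZeros h2 hn0 hYi (by omega) hz
    apply mul_left_cancel₀ h2
    linear_combination h3 + h4

/-- A torus-invariant set of vectors never has the trace distribution of a block. -/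
theorem IsTorusInvariant.false (hV : IsTorusInvariant n q V) (hq : Nat.card F = q)
    (hodd : Odd q) (hq5 : 5 < q) (h2 : (2 : F) ≠ 0) (hn : ¬ IsSquare n)
    (hZ : ∀ f : F → ℤ, ∑ Z ∈ V, ∑ W ∈ V, f (Z * W).trace =
      4 * ((q : ℤ) - 1) * ∑ e, f e - 2 * (q - 1) * (f (2 * n) + f (-(2 * n))))
    (hF : ∀ f : F → F, ∑ Z ∈ V, ∑ W ∈ V, f (Z * W).trace =
      4 * ((q : F) - 1) * ∑ e, f e - 2 * (q - 1) * (f (2 * n) + f (-(2 * n)))) : False := by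
  have hn0 : n ≠ 0 := fun h => hn (h ▸ IsSquare.zero)
  have hcard : Fintype.card F = q := by rw [← hq, Nat.card_eq_fintype_card]
  have hne := hV.upper_left_ne_zero hq (by omega) hn
  obtain ⟨X, hX, Y, hY, hmem, hfib⟩ := hV.exists_two_orbits hq (by omega) h2 hn
  have hXi := hV.isInner X hX
  have hYi := hV.isInner Y hY
  have hmomZ : ∀ f : F → ℤ, (∀ e, f (-e) = f e) →
      (∑ y, f (torusForm X X y)) + 2 * (∑ y, f (torusForm X Y y)) + ∑ y, f (torusForm Y Y y) =
        4 * ∑ e, f e - 4 * f (2 * n) := fun f hf =>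
    sum_torusForm hq hXi.1 hYi.1 two_ne_zero (by omega) (sum_torusOrbits hmem hfib) f hf (hZ f)
  have hmomF : ∀ f : F → F, (∀ e, f (-e) = f e) →
      (∑ y, f (torusForm X X y)) + 2 * (∑ y, f (torusForm X Y y)) + ∑ y, f (torusForm Y Y y) =
        4 * ∑ e, f e - 4 * f (2 * n) := fun f hf =>
    sum_torusForm hq hXi.1 hYi.1 h2 (by rw [← hcard, FiniteField.cast_card_eq_zero]; simp)
      (sum_torusOrbits hmem hfib) f hf (hF f)
  have hsq := isSquare_mul_of_two_orbits hV hX hY (hne X hX) (hne Y hY) hfib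
  have hadd := hV.add_sq_eq h2 hn hX hY hsq hmomZ
  obtain ⟨a, ha⟩ : ∃ a, a = X 0 0 := ⟨_, rfl⟩
  obtain ⟨b, hb⟩ : ∃ b, b = Y 0 0 := ⟨_, rfl⟩
  have hm : X 0 1 * X 1 0 = b ^ 2 := by
    rw [hb]; linear_combination hXi.2 + hadd
  have hm' : Y 0 1 * Y 1 0 = a ^ 2 := by
    rw [ha]; linear_combination hYi.2 + hadd
  have ha0 : a ≠ 0 := ha ▸ hne X hX
  rw [← ha, ← hb] at hadd
  obtain ⟨k, hk⟩ := hodd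
  have e1 : X 0 1 * X 1 0 * (X 1 0 * X 0 1) = b ^ 4 := by
    linear_combination (X 0 1 * X 1 0 + b ^ 2) * hm
  have e2 : Y 0 1 * Y 1 0 * (Y 1 0 * Y 0 1) = a ^ 4 := by
    linear_combination (Y 0 1 * Y 1 0 + a ^ 2) * hm'
  have e3 : X 0 1 * Y 1 0 * (X 1 0 * Y 0 1) = a ^ 2 * b ^ 2 := by
    linear_combination (Y 0 1 * Y 1 0) * hm + b ^ 2 * hm'
  -- Second moment: with n = a² + b² the two sides are -6n² and -16n².
  have hchar : (5 : F) = 0 := by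
    have h := hmomF (fun e => e ^ 2) (fun e => neg_sq e)
    rw [FiniteField.sum_pow_lt_card_sub_one F 2 (by omega)] at h
    simp only [torusForm] at h
    have hc : 4 < Fintype.card F - 1 := by omega
    rw [sum_units_sq hc, sum_units_sq hc, sum_units_sq hc, ← ha, ← hb] at h
    have h3 : 2 * n ^ 2 * 5 = 0 := by
      rw [hadd] at h ⊢
      linear_combination h + 2 * e1 + 4 * e3 + 2 * e2
    exact (mul_eq_zero.1 h3).resolve_left (mul_ne_zero h2 (pow_ne_zero 2 hn0))
  -- The fourth moment involves exponents up to 8, which must be smaller than q-1.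
  have h25 := twentyfive_le_card_of_five_eq_zero hchar (by omega)
  have h := hmomF (fun e => e ^ 4) (fun e => Even.neg_pow (by decide) e)
  rw [FiniteField.sum_pow_lt_card_sub_one F 4 (by omega)] at h
  simp only [torusForm] at h
  have hc : 8 < Fintype.card F - 1 := by omega
  rw [sum_units_pow_four hc, sum_units_pow_four hc, sum_units_pow_four hc, ← ha, ← hb] at h
  rw [e1, e2, e3] at h
  have h3 : 2 * n ^ 2 * (a ^ 4 + a ^ 2 * b ^ 2 + b ^ 4) = 0 := by
    rw [hadd] at h ⊢
    linear_combination h - (8 * a ^ 8 + 50 * a ^ 6 * b ^ 2 + 28 * a ^ 4 * b ^ 4 +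
      50 * a ^ 2 * b ^ 6 + 8 * b ^ 8) * hchar
  have h4 := (mul_eq_zero.1 h3).resolve_left (mul_ne_zero h2 (pow_ne_zero 2 hn0))
  -- In characteristic 5, a²n = a⁴ + a²b² = -b⁴ = (2b²)².
  refine hn ⟨2 * b ^ 2 / a, ?_⟩
  field_simp
  rw [hadd]
  linear_combination h4 - b ^ 4 * hchar

end Zeros

/-! ### The nonexistence theorem -/

theorem theorem2p3 (F : Type*) [Field F] [Finite F] (q : ℕ) (P : Type*)
    (𝓑 : Set (Set P)) (G : Subgroup (Equiv.Perm P)) :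
    ¬ IsTypeII F q 𝓑 G := by
  intro h
  have hq := h.card_field
  have hodd := h.odd
  have hq5 := h.five_lt
  have hdes := h.design
  have h2 : (2 : F) ≠ 0 := by
    intro h0
    have := Fintype.ofFinite F
    have h1 : ((q : ℕ) : F) = 0 := by
      rw [← hq, Nat.card_eq_fintype_card, FiniteField.cast_card_eq_zero]
    obtain ⟨k, hk⟩ := hodd
    rw [hk] at h1
    push_cast at h1
    rw [h0, zero_mul, zero_add] at h1
    exact one_ne_zero h1
  classical
  have := Fintype.ofFinite F
  have hpos : 0 < q * (q - 1) / 2 := 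
    Nat.div_pos (Nat.mul_le_mul (show 2 ≤ q by omega) (show 1 ≤ q - 1 by omega)) two_pos
  have : Finite P := Nat.finite_of_card_ne_zero (by rw [hdes.card_points]; omega)
  obtain ⟨Φ₀, hΦ₀⟩ := h.exists_isDihedralAction
  obtain ⟨B, hB⟩ : 𝓑.Nonempty := by
    apply Set.nonempty_of_ncard_ne_zero
    rw [h.card_blocks]
    have : 0 < q * (q + 1) / 2 := Nat.div_pos (by nlinarith) two_pos
    omega
  obtain ⟨Φ, hΦ, hdiag, hanti, htorus⟩ := hΦ₀.exists_torus hq hodd hq5 h2 hB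
  obtain ⟨n, pt, hpt⟩ := hΦ.exists_isPointModel hq hodd hq5 h2 hdes.card_points
  have htrans : ∀ x y, ∃ M, Φ M x = y := by
    intro x y
    obtain ⟨X, hX, rfl⟩ := hpt.surj x
    obtain ⟨Y, hY, rfl⟩ := hpt.surj y
    obtain ⟨M, hM⟩ := hX.slEquiv h2 hpt.not_isSquare hY
    refine ⟨M, ?_⟩
    rw [hpt.equivariant M X hX, hpt.eq_iff _ _ (hX.slConj M) hY]
    rcases hM with hM | hM
    · exact Or.inl hM.symm
    · exact Or.inr (by rw [hM, neg_neg])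
  have hV : IsTorusInvariant n q (blockVectors n pt B) := by
    refine ⟨fun X hX => (mem_blockVectors.1 hX).1, ?_, fun X => hpt.neg_mem_blockVectors,
      fun t X hX => ?_, fun X hX => ?_, fun X hX Y hY => ?_⟩
    · rw [hpt.card_blockVectors h2, hdes.card_block B hB]
    · simpa only [hdiag] using hpt.slConj_mem_blockVectors (slDiag t) hX
    · simpa only [hanti] using hpt.slConj_mem_blockVectors (slAnti 1) hX
    · obtain ⟨hXi, hXB⟩ := mem_blockVectors.1 hX
      obtain ⟨hYi, hYB⟩ := mem_blockVectors.1 hY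
      -- Flag-transitivity enters here, for two flags with the same block: it supplies an element of
      -- the block stabilizer in `G` moving one point to the other.
      obtain ⟨g, hg, hgx, hgB⟩ := h.flag_transitive _ _ B hB B hB hXB hYB
      obtain ⟨l, μ, hμ, hl⟩ := htorus g hg hgB
      obtain ⟨σ, hσ⟩ := hpt.exists_ringHom hΦ.map_eq_one h2 hq hodd (hΦ.normal g hg) hμ hl
      exact ⟨σ, hσ X Y hXi hYi hgx.symm⟩
  exact hV.false hq hodd hq5 h2 hpt.not_isSquare
    (hpt.sum_trace h2 hq hodd (hΦ.blocks_transitive htrans) hdes.card_pair h.card_blocks hB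
      (hdes.card_block B hB))
    (hpt.sum_trace h2 hq hodd (hΦ.blocks_transitive htrans) hdes.card_pair h.card_blocks hB
      (hdes.card_block B hB))
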